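/- Terms are constants or variables (no function symbols), and atomsets are sets of atoms. A nonmonotonic existential (NME) rule $R=(B^+,\mathbf{not}\,B^-_1,\dots,\mathbf{not}\,B^-_k\to H)$ consists of finite atomsets with $\mathrm{vars}(B^-_i)\subseteq\mathrm{vars}(B^+)$; its frontier variables occur in both $B^+$ and $H$, its existential variables only in $H$. It is self-blocking if some $B^-_i\subseteq B^+\cup H$. Rules that are unified are first renamed apart. Unifiers. A unifier of a body $B_2$ with a head $H_1$ is, for some $B_2'\subseteq B_2$, $H_1'\subseteq H_1$, a most general substitution $\mu$ of $\mathrm{vars}(B_2')\cup\mathrm{vars}(H_1')$ with $\mu(B_2')=\mu(H_1')$. It is a piece-unifier if no existential variable of $H_1'$ is unified with a variable that occurs both in $B_2'$ and in $B_2\setminus B_2'$. The unified rule $R_1\diamond_\mu R_2$ has head $\mu(H_1)\cup\mu(H_2)$, positive body $\mu(B_1^+)\cup(\mu(B_2^+)\setminus\mu(H_1))$, and as negative bodies the $\mu(B^-)$ for all negative bodies $B^-$ of $R_1$ and $R_2$; $\mu$ is self-blocking if this rule is. $R_2$ depends on $R_1$ if there is a non-self-blocking piece-unifier of $B_2^+$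 with $H_1$ for some $B_2'\neq\emptyset$; this gives the graph of rule dependencies (GRD) of a finite set $\mathcal R$ of NME rules. Agglomerated rules. Let $P=(R_1,\dots,R_n)$ be a path (vertices may repeat) in the GRD. A rule associated with $P$ is a rule $R^p_n$ obtained as follows: $R^p_1=R_1$, and $R^p_{l+1}$ arises from $R^p_l$ by adding to the body the atoms $\mathrm{fr}(t)$ for all terms $t$ of the head that are unified by some non-self-blocking piece-unifier (possibly with empty $B_2'$) of the positive body of $R_{l+1}$ with the head of $R^p_l$. Here $\mathrm{fr}$ is a fresh predicate, and the head always is that of $R_1$. An agglomerated rule for $(R_i,R_j)$ is the union of rules associated with the paths in a nonempty set of paths from $R_i$ to direct predecessors of $R_j$ in the GRD. Position graph $PG^U(\mathcal R)$. Its nodes are the positions $[a,i]$ ($i$-th argument of $a$) of the atoms $a$ in the positive bodies and heads of the rules. In each rule there is an edge from each body position whose term is a frontier variable to each head position that has the same term or an existential variable as its term (an existential position). There is an edge from $[h,k]$ in the head of $R_i$ to $[b,k]$ in the positive body of $R_j$, where $h$ and $b$ have the same predicate, if some non-self-blocking piece-unifier $\mu$ of the positive body of $R_j$ with the head of an agglomerated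 rule for $(R_i,R_j)$ satisfies $\mu(\mathrm{term}[h,k])=\mu(\mathrm{term}[b,k])$. Compatible cycles. Let $S$ be a rule obtained by composing rules of $\mathcal R$ and let $R\in\mathcal R$. A unifier $\mu$ of the positive body of $R$ with the head of $S$ is compatible if, whenever it unifies the term at a position $[a,i]$ of $B'$ with an existential variable $z$ of $S$ that occurs in $H'$, there is a path in $PG^U(\mathcal R)$ from a position in which $z$ occurs (traced back to the rule that the head atom comes from) to $[a,i]$ which does not go through another existential position. A cycle is a closed walk. A cycle $C$ through an existential position passes in turn through heads and bodies of rules $R_1,R_2,\dots,R_{k+1}=R_1$; a compatible sequence of unifiers induced by $C$ is a sequence $\mu_1,\dots,\mu_k$ where each $\mu_l$ is a compatible unifier of the positive body of $R_{l+1}$ with the head of $R_1\diamond_{\mu_1}\cdots\diamond_{\mu_{l-1}}R_l$ that unifies the two atoms linked by the $l$-th head-to-body edge of $C$. $C$ is compatible if it induces such a sequence, and self-blocking if, for every such sequence, the rule $R_1\diamond_{\mu_1}\cdots\diamond_{\mu_k}R_{k+1}$ is self-blocking. Chase tree. In the skolem chase a rule is applied after replacing each existential variable $z$ of $R$ by $f^R_z(\vec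 x)$, $\vec x$ being the frontier variables. The nodes of a derivation tree have labels $(\mathrm{IN},\mathrm{OUT},\mathrm{MBT})$; the root has the label $(F,\emptyset,\emptyset)$. A node is unsound if some atomset of $\mathrm{OUT}$ is contained in $\mathrm{IN}\cup\mathrm{MBT}$. A node that is not unsound may be expanded with a rule $R$ and a homomorphism $\pi:B^+\to\mathrm{IN}$ if no $\pi(B^-_i)$ is contained in $\mathrm{IN}$ and the application adds a new atom. It then has a positive child, where the head is added to $\mathrm{IN}$ and all $\pi(B^-_i)$ to $\mathrm{OUT}$, and for each $i$ a negative child, where the atoms of $\pi(B^-_i)$ are added to $\mathrm{MBT}$. A branch is sound if it contains no unsound node. A sound branch is complete if any further rule application would add nothing or would cause an instantiated negative body of this or of an earlier applied rule to be contained in the produced atomset. It is stable if it is complete and all atoms of its $\mathrm{MBT}$ fields eventually are in $\mathrm{IN}$. A branch is unprovable if it has a node with nonempty $\mathrm{MBT}$ such that no (finite or infinite) continuation from this node is stable. The skolem chase tree halts on $(F,\mathcal R)$ if there is a finite derivation tree all of whose branches are unsound, unprovable or complete. Proposition. Let $\mathcal R$ be a finite set of NME rules such that, for each existential position $[a,i]$,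 all compatible cycles through $[a,i]$ in $PG^U(\mathcal R)$ are self-blocking. Then the skolem chase tree halts on $(F,\mathcal R)$ for every finite atomset $F$. -/

import Mathlib

namespace NME

/-! ### Function-free terms, atoms, rules -/

/-- Function-free terms: constants from `C` and variables from `V`. -/
inductive Tm (C V : Type*) where
  | const (c : C) : Tm C V
  | var (v : V) : Tm C V

/-- Atoms `p(t₁, …, t_k)` over a type `T` of terms; `ar p` is the arity of the predicate `p`. -/
structure Atom {P : Type*} (ar : P → ℕ) (T : Type*) where
  pred : P
  args : Fin (ar pred) → T

variable {P C V W : Type*} {ar : P → ℕ}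

/-- Apply a substitution to a term. -/
def Tm.subst (μ : V → Tm C W) : Tm C V → Tm C W
  | .const c => .const c
  | .var v => μ v

/-- Apply a map on terms to an atom. -/
def Atom.map {S T : Type*} (f : S → T) (a : Atom ar S) : Atom ar T :=
  ⟨a.pred, fun i => f (a.args i)⟩

/-- Apply a substitution to an atom. -/
def Atom.subst (μ : V → Tm C W) (a : Atom ar (Tm C V)) : Atom ar (Tm C W) :=
  a.map (Tm.subst μ)

/-- The image of an atomset under a substitution. -/
def substSet (μ : V → Tm C W) (A : Set (Atom ar (Tm C V))) : Set (Atom ar (Tm C W)) :=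
  Atom.subst μ '' A

/-- The variables that occur in an atomset. -/
def vars (A : Set (Atom ar (Tm C V))) : Set V :=
  {v | ∃ a ∈ A, ∃ i, a.args i = Tm.var v}

/-- A nonmonotonic existential rule `B⁺, not B₁⁻, …, not B_k⁻ → H`. The atomsets are finite and every
variable of a negative body occurs in the positive body. -/
structure Rule {P : Type*} (ar : P → ℕ) (C V : Type*) where
  body : Finset (Atom ar (Tm C V))
  neg : Finset (Finset (Atom ar (Tm C V)))
  head : Finset (Atom ar (Tm C V))
  safe : ∀ N ∈ neg, vars (N : Set (Atom ar (Tm C V))) ⊆ vars (body : Set (Atom ar (Tm C V)))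

/-- Frontier variables: those in both the positive body and the head. -/
def Rule.frontier (R : Rule ar C V) : Set V :=
  vars (R.body : Set (Atom ar (Tm C V))) ∩ vars (R.head : Set (Atom ar (Tm C V)))

/-- Existential variables: those in the head only. -/
def Rule.exist (R : Rule ar C V) : Set V :=
  vars (R.head : Set (Atom ar (Tm C V))) \ vars (R.body : Set (Atom ar (Tm C V)))

/-! ### Skolem chase tree -/

/-- The terms of the skolem chase: constants, the variables of the fact base (kept as they are), and
functional terms `f^R_z(t⃗)`, with one argument for each frontier variable of `R`. -/
inductive SkTerm {P : Type*} (ar : P → ℕ) (C V : Type*) where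
  | const (c : C) : SkTerm ar C V
  | null (v : V) : SkTerm ar C V
  | skolem (R : Rule ar C V) (z : V) (args : R.frontier → SkTerm ar C V) : SkTerm ar C V

/-- Instantiate a rule term. -/
def Tm.inst (π : V → SkTerm ar C V) : Tm C V → SkTerm ar C V
  | .const c => .const c
  | .var v => π v

/-- Instantiate an atomset. -/
def instSet (π : V → SkTerm ar C V) (A : Set (Atom ar (Tm C V))) :
    Set (Atom ar (SkTerm ar C V)) :=
  Atom.map (Tm.inst π) '' A

open Classical in
/-- The extension of `π` to the head of the skolemized rule: each existential variable `z` is sent to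
the functional term `f^R_z` applied to the images of the frontier variables. -/
noncomputable def Rule.skolemize (R : Rule ar C V) (π : V → SkTerm ar C V) : V → SkTerm ar C V :=
  fun v => if v ∈ R.exist then .skolem R v (fun x => π x) else π v

/-- The atoms added by the application of the skolemized rule `R` according to `π`. -/
noncomputable def Rule.headInst (R : Rule ar C V) (π : V → SkTerm ar C V) :
    Set (Atom ar (SkTerm ar C V)) :=
  instSet (R.skolemize π) R.head

/-- The instantiated negative bodies. -/
def Rule.negInst (R : Rule ar C V) (π : V → SkTerm ar C V) :
    Set (Set (Atom ar (SkTerm ar C V))) :=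
  {O | ∃ N ∈ R.neg, O = instSet π N}

/-- The label of a node: the inferred atoms, the forbidden atomsets, the atoms still to be proven. -/
structure Node {P : Type*} (ar : P → ℕ) (C V : Type*) where
  IN : Set (Atom ar (SkTerm ar C V))
  OUT : Set (Set (Atom ar (SkTerm ar C V)))
  MBT : Set (Atom ar (SkTerm ar C V))

/-- The root for the fact base `F`. -/
def root (F : Finset (Atom ar (Tm C V))) : Node ar C V :=
  ⟨instSet SkTerm.null F, ∅, ∅⟩

/-- A forbidden atomset has been inferred or has to be proven. -/
def Node.Unsound (N : Node ar C V) : Prop :=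
  ∃ O ∈ N.OUT, O ⊆ N.IN ∪ N.MBT

/-- `π` is a homomorphism from the positive body of `R` to `A`. -/
def Applicable (A : Set (Atom ar (SkTerm ar C V))) (R : Rule ar C V) (π : V → SkTerm ar C V) : Prop :=
  instSet π R.body ⊆ A

/-- `N` may be expanded with `(R, π)`: it is not unsound, the rule is applicable, the application is
not blocked, and it produces a new atom. -/
def Node.Expandable (Rs : Finset (Rule ar C V)) (N : Node ar C V) (R : Rule ar C V)
    (π : V → SkTerm ar C V) : Prop :=
  ¬ N.Unsound ∧ R ∈ Rs ∧ Applicable N.IN R π ∧ (∀ O ∈ R.negInst π, ¬ O ⊆ N.IN) ∧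
    ¬ R.headInst π ⊆ N.IN

/-- The positive child: the rule is applied and its negative bodies become forbidden. -/
noncomputable def Node.pos (N : Node ar C V) (R : Rule ar C V) (π : V → SkTerm ar C V) : Node ar C V :=
  ⟨N.IN ∪ R.headInst π, N.OUT ∪ R.negInst π, N.MBT⟩

/-- The negative child for the instantiated negative body `O`: it has to be proven. -/
def Node.negChild (N : Node ar C V) (O : Set (Atom ar (SkTerm ar C V))) : Node ar C V :=
  ⟨N.IN, N.OUT, N.MBT ∪ O⟩

/-- `N'` is one of the children obtained when `N` is expanded with some rule application. -/
def IsChild (Rs : Finset (Rule ar C V)) (N N' : Node ar C V) : Prop :=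
  ∃ R π, N.Expandable Rs R π ∧ (N' = N.pos R π ∨ ∃ O ∈ R.negInst π, N' = N.negChild O)

/-- A derivation that produces `A` and whose applied rules have the instantiated negative bodies `OUT`
is sound, and any other rule application would make it unsound or leave `A` unchanged. -/
def DerivationComplete (Rs : Finset (Rule ar C V)) (A : Set (Atom ar (SkTerm ar C V)))
    (OUT : Set (Set (Atom ar (SkTerm ar C V)))) : Prop :=
  (∀ O ∈ OUT, ¬ O ⊆ A) ∧
  ∀ R ∈ Rs, ∀ π, Applicable A R π →
    R.headInst π ⊆ A ∨ ∃ O ∈ OUT ∪ R.negInst π, O ⊆ A ∪ R.headInst π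

/-- Some finite or infinite continuation of the branch at `N` is sound, complete and stable (every
atom that must be true is eventually inferred). Repeated nodes allow for finite continuations. -/
def HasStableContinuation (Rs : Finset (Rule ar C V)) (N : Node ar C V) : Prop :=
  ∃ c : ℕ → Node ar C V, c 0 = N ∧ (∀ n, c (n + 1) = c n ∨ IsChild Rs (c n) (c (n + 1))) ∧
    (∀ n, ¬ (c n).Unsound) ∧
    DerivationComplete Rs (⋃ n, (c n).IN) (⋃ n, (c n).OUT) ∧
    (⋃ n, (c n).MBT) ⊆ ⋃ n, (c n).IN

/-- Something has to be proven at `N`, and no complete branch through `N` is stable. -/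
def Node.Unprovable (Rs : Finset (Rule ar C V)) (N : Node ar C V) : Prop :=
  N.MBT.Nonempty ∧ ¬ HasStableContinuation Rs N

/-- `FiniteChaseTree Rs N`: there is a finite derivation tree with root `N` each of whose branches
is unsound, complete or unprovable. -/
inductive FiniteChaseTree (Rs : Finset (Rule ar C V)) : Node ar C V → Prop
  | unsound (N : Node ar C V) : N.Unsound → FiniteChaseTree Rs N
  | complete (N : Node ar C V) :
      ¬ N.Unsound → DerivationComplete Rs N.IN N.OUT → FiniteChaseTree Rs N
  | unprovable (N : Node ar C V) : N.Unprovable Rs → FiniteChaseTree Rs N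
  | expand (N : Node ar C V) (R : Rule ar C V) (π : V → SkTerm ar C V) :
      N.Expandable Rs R π → FiniteChaseTree Rs (N.pos R π) →
      (∀ O ∈ R.negInst π, FiniteChaseTree Rs (N.negChild O)) → FiniteChaseTree Rs N

/-- The skolem chase tree halts on `(F, Rs)`. -/
def SkolemChaseTreeHalts (Rs : Finset (Rule ar C V)) (F : Finset (Atom ar (Tm C V))) : Prop :=
  FiniteChaseTree Rs (root F)

/-! ### Unifiers and unified rules

Rules that are unified with each other must not share variables (even if they are the same rule), so
the `n`-th rule of a sequence uses the variables `(n, v)`. -/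

/-- The renaming of variables for the `n`-th rule of a sequence. -/
def ren (n : ℕ) : V → Tm C (ℕ × V) := fun v => .var (n, v)

/-- A rule obtained by composition. A head atom is stored as `(R, h, θ)`: it is the instance `θ(h)` of
the head atom `h` of the rule `R`, so that its positions can be traced back to `R`. -/
structure CRule {P : Type*} (ar : P → ℕ) (C V : Type*) where
  body : Set (Atom ar (Tm C (ℕ × V)))
  neg : Set (Set (Atom ar (Tm C (ℕ × V))))
  head : Set (Rule ar C V × Atom ar (Tm C V) × (V → Tm C (ℕ × V)))

/-- The head of a composed rule as an atomset. -/
def CRule.headAtoms (S : CRule ar C V) : Set (Atom ar (Tm C (ℕ × V))) :=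
  {a | ∃ R h θ, (R, h, θ) ∈ S.head ∧ a = h.subst θ}

/-- The existential variables of a composed rule. -/
def CRule.exist (S : CRule ar C V) : Set (ℕ × V) := vars S.headAtoms \ vars S.body

/-- The `n`-th copy of a rule. -/
def Rule.copy (R : Rule ar C V) (n : ℕ) : CRule ar C V where
  body := substSet (ren n) R.body
  neg := {A | ∃ N ∈ R.neg, A = substSet (ren n) N}
  head := {x | ∃ h ∈ R.head, x = (R, h, ren n)}

/-- The unified rule `S ⋄_μ T`: its head is `μ(H_S) ∪ μ(H_T)`, its positive body is
`μ(B_S) ∪ (μ(B_T) \ μ(H_S))`, its negative bodies are the `μ(N)` for the negative bodies `N` of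
`S` and `T`. -/
def CRule.comp (S T : CRule ar C V) (μ : ℕ × V → Tm C (ℕ × V)) : CRule ar C V where
  body := substSet μ S.body ∪ (substSet μ T.body \ substSet μ S.headAtoms)
  neg := substSet μ '' (S.neg ∪ T.neg)
  head := (fun x => (x.1, x.2.1, fun v => (x.2.2 v).subst μ)) '' (S.head ∪ T.head)

/-- Some negative body is contained in the union of the positive body and the head. -/
def CRule.SelfBlocking (S : CRule ar C V) : Prop :=
  ∃ N ∈ S.neg, N ⊆ S.body ∪ S.headAtoms

/-- `μ` is a (most general) unifier of the body `B` with the head `H`, for the subsets `B' ⊆ B` and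
`H' ⊆ H`: a substitution of the variables of `B'` and `H'` (no other variable is changed or
introduced) such that `μ(B') = μ(H')`, and such that no unifier of `B'` with `H'` is strictly more
general. -/
structure IsUnifier (B H B' H' : Set (Atom ar (Tm C W))) (μ : W → Tm C W) : Prop where
  body_sub : B' ⊆ B
  head_sub : H' ⊆ H
  dom : ∀ w, w ∉ vars B' ∪ vars H' → μ w = .var w
  range : ∀ w ∈ vars B' ∪ vars H', ∀ u, μ w = .var u → u ∈ vars B' ∪ vars H'
  unifies : substSet μ B' = substSet μ H'
  most_general : ∀ ν : W → Tm C W, substSet ν B' = substSet ν H' →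
    (∃ δ : W → Tm C W, ∀ w ∈ vars B' ∪ vars H', μ w = (ν w).subst δ) →
    ∃ ε : W → Tm C W, ∀ w ∈ vars B' ∪ vars H', ν w = (μ w).subst ε

/-- A piece-unifier of `B` with `H`, where `E` is the set of existential variables of the rule with
head `H`: no existential variable of `H'` is unified with a separating variable of `B'`, i.e. a
variable that occurs both in `B'` and in `B \ B'`. -/
def IsPieceUnifier (B H : Set (Atom ar (Tm C W))) (E : Set W) (B' H' : Set (Atom ar (Tm C W)))
    (μ : W → Tm C W) : Prop :=
  IsUnifier B H B' H' μ ∧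
    ∀ x ∈ vars B' ∩ vars (B \ B'), ∀ z ∈ vars H' ∩ E, μ x ≠ μ z

/-- `μ` is a piece-unifier of the body of `R'` with the head of `R` that is not self-blocking, when
the variables in `T` are not counted as existential variables of `R`. The rule `R` uses the
variables `(0, v)`, the rule `R'` the variables `(1, v)`. -/
def PieceUnifies (R : Rule ar C V) (T : Set V) (R' : Rule ar C V)
    (B' H' : Set (Atom ar (Tm C (ℕ × V)))) (μ : ℕ × V → Tm C (ℕ × V)) : Prop :=
  IsPieceUnifier (R'.copy 1).body (R.copy 0).headAtoms (Prod.mk 0 '' (R.exist \ T)) B' H' μ ∧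
    ¬ ((R.copy 0).comp (R'.copy 1) μ).SelfBlocking

/-- `R'` depends on `R`: some piece-unifier of the body of `R'` with the head of `R`, which unifies at
least one atom, is not self-blocking. These pairs are the edges of the graph of rule dependencies. -/
def Depends (R R' : Rule ar C V) : Prop :=
  ∃ B' H' μ, B'.Nonempty ∧ PieceUnifies R ∅ R' B' H' μ

/-- `AggPath Rs R R' T`: for some path from `R` to `R'` in the graph of rule dependencies, the rule
`B_R ∪ {fr(t) | t ∈ T} → H_R` can be associated with the path. It is obtained by going along the path:
for the next rule of the path, a piece-unifier of its body with the head of the rule built so far is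
chosen, and the atoms `fr(t)` for the unified head terms `t` are added to the body. As `fr` is a fresh
predicate, the only effect of these atoms is that the variables in `T` are no longer existential, so
that the rule is represented by `R` and `T`. -/
inductive AggPath (Rs : Finset (Rule ar C V)) (R : Rule ar C V) : Rule ar C V → Set V → Prop
  | nil : R ∈ Rs → AggPath Rs R R ∅
  | step {R₁ R₂ : Rule ar C V} {T : Set V} {B' H' : Set (Atom ar (Tm C (ℕ × V)))}
      {μ : ℕ × V → Tm C (ℕ × V)} :
      AggPath Rs R R₁ T → R₂ ∈ Rs → Depends R₁ R₂ → PieceUnifies R T R₂ B' H' μ →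
      AggPath Rs R R₂ (T ∪ {v | (0, v) ∈ vars H'})

/-- `B_R ∪ {fr(t) | t ∈ T} → H_R` is an agglomerated rule associated with `(R, R')`: it is the union
of the rules associated with a nonempty set of paths from `R` to direct predecessors of `R'`. -/
def Agglomerated (Rs : Finset (Rule ar C V)) (R R' : Rule ar C V) (T : Set V) : Prop :=
  ∃ Q : Set (Rule ar C V × Set V), Q.Nonempty ∧
    (∀ q ∈ Q, AggPath Rs R q.1 q.2 ∧ Depends q.1 R') ∧ T = ⋃ q ∈ Q, q.2

/-! ### The position graph with unifiers -/

/-- A position `[a, i]`, where `a` is an atom in the head or in the positive body of a rule. -/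
structure Pos {P : Type*} (ar : P → ℕ) (C V : Type*) where
  rule : Rule ar C V
  inHead : Bool
  atom : Atom ar (Tm C V)
  idx : Fin (ar atom.pred)

/-- The term at a position. -/
def Pos.term (p : Pos ar C V) : Tm C V := p.atom.args p.idx

/-- `p` is a position in the head of a rule of `Rs`. -/
def Pos.IsHead (Rs : Finset (Rule ar C V)) (p : Pos ar C V) : Prop :=
  p.rule ∈ Rs ∧ p.inHead = true ∧ p.atom ∈ p.rule.head

/-- `p` is a position in the positive body of a rule of `Rs`. -/
def Pos.IsBody (Rs : Finset (Rule ar C V)) (p : Pos ar C V) : Prop :=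
  p.rule ∈ Rs ∧ p.inHead = false ∧ p.atom ∈ p.rule.body

/-- `p` is an existential position. -/
def Pos.IsExistential (Rs : Finset (Rule ar C V)) (p : Pos ar C V) : Prop :=
  p.IsHead Rs ∧ ∃ z ∈ p.rule.exist, p.term = .var z

/-- Edges of the position graphs of the single rules: from a frontier position in the body to a head
position that has the same term or is existential. -/
def InternalEdge (Rs : Finset (Rule ar C V)) (p q : Pos ar C V) : Prop :=
  p.IsBody Rs ∧ q.IsHead Rs ∧ p.rule = q.rule ∧ (∃ x ∈ p.rule.frontier, p.term = .var x) ∧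
    (p.term = q.term ∨ q.IsExistential Rs)

/-- Transition edges: from the `k`-th position of a head atom of `R` to the `k`-th position of a body
atom of `R'` with the same predicate, if the two terms are unified by a piece-unifier of the body of
`R'` with the head of an agglomerated rule associated with `(R, R')`. -/
def TransitionEdge (Rs : Finset (Rule ar C V)) (p q : Pos ar C V) : Prop :=
  p.IsHead Rs ∧ q.IsBody Rs ∧ p.atom.pred = q.atom.pred ∧ (p.idx : ℕ) = q.idx ∧
    ∃ T B' H' μ, Agglomerated Rs p.rule q.rule T ∧ PieceUnifies p.rule T q.rule B' H' μ ∧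
      (p.term.subst (ren 0)).subst μ = (q.term.subst (ren 1)).subst μ

/-- The edges of the position graph with unifiers. -/
def Edge (Rs : Finset (Rule ar C V)) (p q : Pos ar C V) : Prop :=
  InternalEdge Rs p q ∨ TransitionEdge Rs p q

/-- A cycle for `p` (a closed walk through `p`) in the position graph, where `p` is a head position.
As head positions have edges to body positions only, and conversely, its length is an even number
`2 * k`; the `c (2 * l)` are head positions and the `c (2 * l + 1)` are body positions. -/
def IsCycle (Rs : Finset (Rule ar C V)) (p : Pos ar C V) (k : ℕ) (c : ℕ → Pos ar C V) : Prop :=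
  0 < k ∧ c 0 = p ∧ c (2 * k) = p ∧ ∀ m < 2 * k, Edge Rs (c m) (c (m + 1))

/-! ### Compatible sequences of unifiers -/

/-- The unifier `μ` of the body of `R` (its `n`-th copy) with the head of `S` is compatible: if it
unifies the term at a position `[a, i]` of `B'` with an existential variable `z` of `S` that occurs in
`H'`, then the position graph has a path to `[a, i]` from a position in which `z` occurs, which does
not go through another existential position. -/
def CompatibleUnifier (Rs : Finset (Rule ar C V)) (S : CRule ar C V) (R : Rule ar C V) (n : ℕ)
    (B' H' : Set (Atom ar (Tm C (ℕ × V)))) (μ : ℕ × V → Tm C (ℕ × V)) : Prop :=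
  IsUnifier (R.copy n).body S.headAtoms B' H' μ ∧
  ∀ a ∈ R.body, a.subst (ren n) ∈ B' → ∀ i : Fin (ar a.pred), ∀ z ∈ S.exist ∩ vars H',
    ((a.args i).subst (ren n)).subst μ = μ z →
    ∃ p : Pos ar C V, (∃ θ, (p.rule, p.atom, θ) ∈ S.head ∧ p.term.subst θ = .var z) ∧
      Relation.TransGen (fun x y => Edge Rs x y ∧ ¬ y.IsExistential Rs) p ⟨R, false, a, i⟩

/-- The rule `(… (R₀ ⋄ R₁) ⋄ …) ⋄ R_l` for the rules `R₀, R₁, …` of the head positions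
`c 0, c 2, …` of a cycle. -/
def composed (c : ℕ → Pos ar C V) (μ : ℕ → ℕ × V → Tm C (ℕ × V)) : ℕ → CRule ar C V
  | 0 => (c 0).rule.copy 0
  | l + 1 => (composed c μ l).comp ((c (2 * (l + 1))).rule.copy (l + 1)) (μ l)

/-- The atom of the head position `c (2 * l)`, as it occurs in the head of `composed c μ l`. -/
def headAtom (c : ℕ → Pos ar C V) (μ : ℕ → ℕ × V → Tm C (ℕ × V)) : ℕ → Atom ar (Tm C (ℕ × V))
  | 0 => (c 0).atom.subst (ren 0)
  | l + 1 => ((c (2 * (l + 1))).atom.subst (ren (l + 1))).subst (μ l)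

/-- `μ 0, …, μ (k - 1)` is a compatible sequence of unifiers induced by the cycle `c`: each `μ l` is a
compatible unifier of the body of the next rule with the head of the rule composed so far, and it
unifies the two atoms that are linked by the `l`-th transition edge of the cycle. -/
def InducedCompatible (Rs : Finset (Rule ar C V)) (k : ℕ) (c : ℕ → Pos ar C V)
    (μ : ℕ → ℕ × V → Tm C (ℕ × V)) : Prop :=
  ∀ l < k, ∃ B' H',
    CompatibleUnifier Rs (composed c μ l) (c (2 * (l + 1))).rule (l + 1) B' H' (μ l) ∧
    headAtom c μ l ∈ H' ∧ (c (2 * l + 1)).atom.subst (ren (l + 1)) ∈ B' ∧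
    (headAtom c μ l).subst (μ l) = ((c (2 * l + 1)).atom.subst (ren (l + 1))).subst (μ l)

/-- A compatible cycle: a cycle that induces some compatible sequence of unifiers. -/
def IsCompatibleCycle (Rs : Finset (Rule ar C V)) (p : Pos ar C V) (k : ℕ)
    (c : ℕ → Pos ar C V) : Prop :=
  IsCycle Rs p k c ∧ ∃ μ, InducedCompatible Rs k c μ

/-- A cycle is self-blocking if, for all compatible sequences of unifiers that it induces, the rule
obtained by combining them is self-blocking. -/
def SelfBlockingCycle (Rs : Finset (Rule ar C V)) (k : ℕ) (c : ℕ → Pos ar C V) : Prop :=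
  ∀ μ, InducedCompatible Rs k c μ → (composed c μ k).SelfBlocking

end NME

/-! Suppose that a node is the root of no suitable finite tree. Some rule application at it then has
a positive child that is not unsound, since otherwise the node would be unsound, complete or
unprovable (`unprovable_of_not_useful`); and some child of this application again has no finite
tree. This gives an infinite branch without unsound nodes. The pair (`IN`, `MBT`) grows strictly
along it, so a contradiction arises once the branch is confined to finitely many atoms, that is,
once the nesting depth of functional terms is bounded. No fairness of the branch is needed.

The positive steps of the branch form a sound derivation. If a term is nested more deeply than there
are existential positions, going back from terms to their arguments and to the steps that create
them meets some existential position twice (`Deriv.exists_recurrence`). The route of the terms in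
between is a closed walk, and it remains to see that it is a compatible cycle of the position graph
that is not self-blocking.

All of this is read off from the ground instantiation given by the derivation. It equates the atoms
to be unified, and some most general unifier factors it (`exists_unifier`). Hence every unified rule
has its positive body and head inside the derived atomset and its negative bodies not contained in
it, so it cannot block itself (`CRule.Realised`). The delicate point is the piece condition, which
fails when a term created at one step also reaches another step through atoms produced in between.
For mere dependency, the detour through those intermediate steps gives a path (`transGen_dep_aux`).
For transition edges, where the walk is closed, an agglomerated rule that is maximal among those of
closed paths has already turned all offending existential variables into frontier variables
(`mem_maximal`). Compatibility follows by tracing each existential variable of a composed rule to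
the step that creates its value (`exists_origin`, `Created.exists_path`). -/

namespace NME

variable {P C V W X : Type*} {ar : P → ℕ}

/-! ### Ground evaluation and most general unifiers that factor it. -/

/-- Evaluate a term under a ground instantiation of its variables. -/
def Tm.ev (σ : W → SkTerm ar C V) : Tm C W → SkTerm ar C V
  | .const c => .const c
  | .var w => σ w

/-- Evaluate an atom under a ground instantiation of its variables. -/
def Atom.ev (σ : W → SkTerm ar C V) (a : Atom ar (Tm C W)) : Atom ar (SkTerm ar C V) :=
  a.map (Tm.ev σ)

theorem Tm.ev_subst (σ : W → SkTerm ar C V) (μ : X → Tm C W) (t : Tm C X) :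
    (t.subst μ).ev σ = t.ev fun x => (μ x).ev σ := by
  cases t <;> rfl

theorem Atom.ev_subst (σ : W → SkTerm ar C V) (μ : X → Tm C W) (a : Atom ar (Tm C X)) :
    (a.subst μ).ev σ = a.ev fun x => (μ x).ev σ := by
  simp only [Atom.ev, Atom.subst, Atom.map, Tm.ev_subst]

theorem Tm.subst_subst {Y : Type*} (μ : X → Tm C W) (θ : Y → Tm C X) (t : Tm C Y) :
    (t.subst θ).subst μ = t.subst fun y => (θ y).subst μ := by
  cases t <;> rfl

theorem Atom.subst_subst {Y : Type*} (μ : X → Tm C W) (θ : Y → Tm C X) (a : Atom ar (Tm C Y)) :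
    (a.subst θ).subst μ = a.subst fun y => (θ y).subst μ := by
  simp only [Atom.subst, Atom.map, Tm.subst_subst]

theorem Tm.inst_eq_ev (π : V → SkTerm ar C V) : Tm.inst π = Tm.ev π := by
  funext t; cases t <;> rfl

theorem Tm.ev_congr {σ τ : W → SkTerm ar C V} {t : Tm C W} (h : ∀ w, t = .var w → σ w = τ w) :
    t.ev σ = t.ev τ := by
  cases t with
  | const c => rfl
  | var w => exact h w rfl

theorem Atom.ev_congr {σ τ : W → SkTerm ar C V} {a : Atom ar (Tm C W)}
    (h : ∀ i w, a.args i = .var w → σ w = τ w) : a.ev σ = a.ev τ := by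
  simp only [Atom.ev, Atom.map]
  congr 1
  funext i
  exact Tm.ev_congr (h i)

theorem Atom.map_eq_map {S S' T : Type*} {f : S → T} {g : S' → T} {a : Atom ar S} {b : Atom ar S'}
    (h : a.map f = b.map g) :
    a.pred = b.pred ∧ ∀ (i : Fin _) (j : Fin _), (i : ℕ) = (j : ℕ) → f (a.args i) = g (b.args j) := by
  obtain ⟨p, x⟩ := a
  obtain ⟨q, y⟩ := b
  simp only [Atom.map, Atom.mk.injEq] at h
  obtain ⟨rfl, h⟩ := h
  refine ⟨rfl, fun i j hij => ?_⟩
  obtain rfl : i = j := Fin.ext hij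
  exact congrFun (eq_of_heq h) i

/-- The terms that occur in an atomset. -/
def terms (A : Set (Atom ar X)) : Set X := {t | ∃ a ∈ A, ∃ i, a.args i = t}

theorem finite_terms {A : Set (Atom ar X)} (hA : A.Finite) : (terms A).Finite := by
  have : terms A = ⋃ a ∈ A, Set.range a.args := by
    ext t; simp [terms]
  rw [this]
  exact hA.biUnion fun a _ => Set.finite_range _

/-- Ground terms are represented by function-free ones: some substitution identifies exactly the
terms with the same value. -/
theorem exists_abstraction (σ : W → SkTerm ar C V) :
    ∃ ν : W → Tm C W, (∀ s t : Tm C W, s.ev σ = t.ev σ → s.subst ν = t.subst ν) ∧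
      ∀ t : Tm C W, (t.subst ν).ev σ = t.ev σ := by
  classical
  rcases isEmpty_or_nonempty W with h | h
  · refine ⟨Tm.var, fun s t hst => ?_, fun t => ?_⟩
    · cases s with
      | const c => cases t with
        | const d => simpa [Tm.ev, Tm.subst] using hst
        | var w => exact h.elim w
      | var w => exact h.elim w
    · cases t with
      | const c => rfl
      | var w => exact h.elim w
  -- `r` picks a representative of each value: the constant itself if the value is one, because
  -- substitutions fix constants, and otherwise a variable with this value.
  · let r : SkTerm ar C V → Tm C W := fun x => if hx : ∃ c, x = .const c then .const hx.choose
      else .var (Function.invFun σ x)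
    have hr : ∀ t : Tm C W, t.subst (fun w => r (σ w)) = r (t.ev σ) := by
      intro t
      cases t with
      | const c =>
        have hx : ∃ c', (SkTerm.const c : SkTerm ar C V) = .const c' := ⟨c, rfl⟩
        have hc := SkTerm.const.inj hx.choose_spec
        simp only [Tm.subst, Tm.ev, r, hx, dif_pos]
        exact congrArg _ hc
      | var w => rfl
    refine ⟨fun w => r (σ w), fun s t hst => by rw [hr, hr, hst], fun t => ?_⟩
    rw [hr]
    by_cases hx : ∃ c, t.ev σ = .const c
    · simp only [r, hx, dif_pos]
      exact hx.choose_spec.symm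
    · simp only [r, hx, dif_neg, not_false_eq_true]
      cases t with
      | const c => exact absurd ⟨c, rfl⟩ hx
      | var w => exact Function.invFun_eq ⟨w, rfl⟩

theorem Atom.subst_eq_subst {σ : W → SkTerm ar C V} {ν : W → Tm C X}
    (h : ∀ s t : Tm C W, s.ev σ = t.ev σ → s.subst ν = t.subst ν) {a b : Atom ar (Tm C W)}
    (hab : a.ev σ = b.ev σ) : a.subst ν = b.subst ν := by
  have hab' := Atom.map_eq_map hab
  obtain ⟨p, x⟩ := a
  obtain ⟨q, y⟩ := b
  obtain ⟨rfl, h'⟩ := hab'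
  simp only [Atom.subst, Atom.map]
  congr 1
  funext i
  exact h _ _ (h' i i rfl)

/-- Two finite atomsets with the same value under a ground instantiation `σ` have a unifier in the
sense of `IsUnifier` through which `σ` factors. -/
theorem exists_unifier {B H B' H' : Set (Atom ar (Tm C W))} (hB : B' ⊆ B) (hH : H' ⊆ H)
    (fB : B'.Finite) (fH : H'.Finite) (σ : W → SkTerm ar C V)
    (hσ : Atom.ev σ '' B' = Atom.ev σ '' H') :
    ∃ μ, IsUnifier B H B' H' μ ∧ ∀ w, (μ w).ev σ = σ w := by
  classical
  set D : Set (Tm C W) := terms (B' ∪ H') with hD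
  have fD : D.Finite := finite_terms (fB.union fH)
  have hvar : ∀ w, w ∈ vars B' ∪ vars H' ↔ Tm.var w ∈ D := by
    intro w
    simp only [hD, terms, vars, Set.mem_union, Set.mem_ofPred_eq]
    constructor
    · rintro (⟨a, ha, h⟩ | ⟨a, ha, h⟩)
      exacts [⟨a, .inl ha, h⟩, ⟨a, .inr ha, h⟩]
    · rintro ⟨a, ha | ha, h⟩
      exacts [.inl ⟨a, ha, h⟩, .inr ⟨a, ha, h⟩]
  -- Among the unifiers that identify no more terms of `D` than `σ` does, one with an
  -- inclusion-minimal kernel is most general. It exists because kernels are subsets of the finite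
  -- set `D × D`.
  let ker : (W → Tm C W) → Set (Tm C W × Tm C W) :=
    fun ν => {p | p.1 ∈ D ∧ p.2 ∈ D ∧ p.1.subst ν = p.2.subst ν}
  let Cand : Set (W → Tm C W) := {ν | substSet ν B' = substSet ν H' ∧
    ∀ s ∈ D, ∀ t ∈ D, s.subst ν = t.subst ν → s.ev σ = t.ev σ}
  have hfin : (ker '' Cand).Finite := by
    refine ((fD.prod fD).finite_subsets).subset ?_
    rintro _ ⟨ν, -, rfl⟩ p hp
    exact ⟨hp.1, hp.2.1⟩
  have hne : (ker '' Cand).Nonempty := by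
    obtain ⟨ν, h1, h2⟩ := exists_abstraction σ
    refine ⟨_, ν, ⟨?_, fun s _ t _ hst => by rw [← h2 s, ← h2 t, hst]⟩, rfl⟩
    have key : ∀ X Y : Set (Atom ar (Tm C W)), Atom.ev σ '' X = Atom.ev σ '' Y →
        substSet ν X ⊆ substSet ν Y := by
      rintro X Y hXY _ ⟨a, ha, rfl⟩
      have : a.ev σ ∈ Atom.ev σ '' Y := hXY ▸ ⟨a, ha, rfl⟩
      obtain ⟨b, hb, hab⟩ := this
      exact ⟨b, hb, Atom.subst_eq_subst h1 hab⟩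
    exact (key _ _ hσ).antisymm (key _ _ hσ.symm)
  obtain ⟨k, ⟨⟨ν, hν, rfl⟩, hmin⟩⟩ := hfin.exists_minimal hne
  -- `ν` may introduce foreign variables. `ρ` sends each value of `ν` on `D` back to a term of `D`
  -- with that value, which gives the range condition for `μ` and keeps the kernel.
  let ρ : Tm C W → Tm C W := fun x => if ∃ c, Tm.const c ∈ D ∧ x = .const c then x
    else if hx : ∃ u, Tm.var u ∈ D ∧ ν u = x then .var hx.choose else x
  have hρ : ∀ t ∈ D, ρ (t.subst ν) ∈ D ∧ (ρ (t.subst ν)).subst ν = t.subst ν := by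
    intro t ht
    by_cases h1 : ∃ c, Tm.const c ∈ D ∧ t.subst ν = .const c
    · obtain ⟨c, hc, hct⟩ := id h1
      simp only [ρ, h1, if_true]
      rw [hct]
      exact ⟨hc, rfl⟩
    · cases t with
      | const c => exact absurd ⟨c, ht, rfl⟩ h1
      | var w =>
        have h2 : ∃ u, Tm.var u ∈ D ∧ ν u = (Tm.var w : Tm C W).subst ν := ⟨w, ht, rfl⟩
        simp only [ρ, h1, if_false, h2, dif_pos]
        exact h2.choose_spec
  let μ : W → Tm C W := fun w => if Tm.var w ∈ D then ρ (ν w) else .var w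
  have hμ : ∀ t ∈ D, t.subst μ = ρ (t.subst ν) := by
    intro t ht
    cases t with
    | const c =>
      have h1 : ∃ c', Tm.const c' ∈ D ∧ (Tm.const c : Tm C W) = .const c' := ⟨c, ht, rfl⟩
      simp only [Tm.subst, ρ, if_pos h1]
    | var w => simp only [Tm.subst, μ, ht, if_true]
  have hmem : ∀ t ∈ D, t.subst μ ∈ D := fun t ht => hμ t ht ▸ (hρ t ht).1
  have hidem : ∀ t ∈ D, (t.subst μ).subst ν = t.subst ν := fun t ht => by
    rw [hμ t ht]; exact (hρ t ht).2
  refine ⟨μ, ⟨hB, hH, ?_, ?_, ?_, ?_⟩, ?_⟩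
  · intro w hw
    rw [hvar] at hw
    simp only [μ, hw, if_false]
  · intro w hw u hu
    rw [hvar] at hw ⊢
    rw [← hu]
    exact hmem _ hw
  · have key : ∀ X ⊆ B' ∪ H', substSet μ X = Atom.map ρ '' substSet ν X := by
      intro X hX
      rw [substSet, substSet, Set.image_image]
      refine Set.image_congr fun a ha => ?_
      simp only [Atom.subst, Atom.map]
      congr 1
      funext i
      exact hμ _ ⟨a, hX ha, i, rfl⟩
    rw [key _ Set.subset_union_left, key _ Set.subset_union_right, hν.1]
  -- A more general unifier `ξ` has a smaller kernel, hence the same one by minimality. As `ν`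
  -- identifies `w` with `μ w`, so does `ξ`, and `ξ` itself serves as `ε`.
  · rintro ξ hξ ⟨δ, hδ⟩
    have hker : ∀ s ∈ D, ∀ t ∈ D, s.subst ξ = t.subst ξ → s.subst ν = t.subst ν := by
      have hfac : ∀ t ∈ D, t.subst μ = (t.subst ξ).subst δ := by
        intro t ht
        cases t with
        | const c => rfl
        | var w => exact hδ w ((hvar w).2 ht)
      intro s hs t ht hst
      rw [← hidem s hs, ← hidem t ht, hfac s hs, hfac t ht, hst]
    have hle : ker ξ ⊆ ker ν := fun p hp => ⟨hp.1, hp.2.1, hker _ hp.1 _ hp.2.1 hp.2.2⟩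
    have hge : ker ν ⊆ ker ξ :=
      hmin ⟨ξ, ⟨hξ, fun s hs t ht hst => hν.2 s hs t ht (hker s hs t ht hst)⟩, rfl⟩ hle
    refine ⟨ξ, fun w hw => ?_⟩
    have hw' := (hvar w).1 hw
    have := hge (a := (Tm.var w, μ w)) ⟨hw', hmem _ hw', (hidem _ hw').symm⟩
    exact this.2.2
  · intro w
    by_cases hw : Tm.var w ∈ D
    · exact hν.2 _ (hmem _ hw) _ hw (hidem _ hw)
    · simp only [μ, hw, if_false, Tm.ev]

/-! ### Realised composed rules -/

/-- The positive body and the head of `S` are mapped into `A`, and no negative body is. -/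
def CRule.Realised (S : CRule ar C V) (σ : ℕ × V → SkTerm ar C V)
    (A : Set (Atom ar (SkTerm ar C V))) : Prop :=
  (∀ a ∈ S.body ∪ S.headAtoms, a.ev σ ∈ A) ∧ ∀ N ∈ S.neg, ¬ Atom.ev σ '' N ⊆ A

theorem CRule.Realised.not_selfBlocking {S : CRule ar C V} {σ : ℕ × V → SkTerm ar C V}
    {A : Set (Atom ar (SkTerm ar C V))} (h : S.Realised σ A) : ¬ S.SelfBlocking := by
  rintro ⟨N, hN, hsub⟩
  refine h.2 N hN ?_
  rintro _ ⟨a, ha, rfl⟩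
  exact h.1 a (hsub ha)

theorem CRule.headAtoms_comp (S T : CRule ar C V) (μ : ℕ × V → Tm C (ℕ × V)) :
    (S.comp T μ).headAtoms = substSet μ (S.headAtoms ∪ T.headAtoms) := by
  ext a
  constructor
  · rintro ⟨R, h, θ, ⟨⟨R', h', θ'⟩, hx, heq⟩, rfl⟩
    simp only [Prod.mk.injEq] at heq
    obtain ⟨rfl, rfl, rfl⟩ := heq
    refine ⟨h'.subst θ', ?_, by rw [Atom.subst_subst]⟩
    exact hx.imp (fun hx => ⟨R', h', θ', hx, rfl⟩) (fun hx => ⟨R', h', θ', hx, rfl⟩)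
  · rintro ⟨_, ⟨R, h, θ, hx, rfl⟩ | ⟨R, h, θ, hx, rfl⟩, rfl⟩
    · exact ⟨R, h, _, ⟨(R, h, θ), .inl hx, rfl⟩, by rw [Atom.subst_subst]⟩
    · exact ⟨R, h, _, ⟨(R, h, θ), .inr hx, rfl⟩, by rw [Atom.subst_subst]⟩

theorem Rule.headAtoms_copy (R : Rule ar C V) (n : ℕ) :
    (R.copy n).headAtoms = substSet (ren n) R.head := by
  ext a
  constructor
  · rintro ⟨R', h, θ, ⟨h', hh, heq⟩, rfl⟩
    simp only [Prod.mk.injEq] at heq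
    obtain ⟨rfl, rfl, rfl⟩ := heq
    exact ⟨h, hh, rfl⟩
  · rintro ⟨h, hh, rfl⟩
    exact ⟨R, h, ren n, ⟨h, hh, rfl⟩, rfl⟩

theorem CRule.Realised.comp {S T : CRule ar C V} {σ : ℕ × V → SkTerm ar C V}
    {A : Set (Atom ar (SkTerm ar C V))} (hS : S.Realised σ A) (hT : T.Realised σ A)
    {μ : ℕ × V → Tm C (ℕ × V)} (hμ : ∀ w, (μ w).ev σ = σ w) : (S.comp T μ).Realised σ A := by
  have hev : ∀ a : Atom ar (Tm C (ℕ × V)), (a.subst μ).ev σ = a.ev σ := fun a => by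
    rw [Atom.ev_subst]; congr 1; funext w; exact hμ w
  refine ⟨?_, ?_⟩
  · rw [CRule.headAtoms_comp]
    rintro _ ((⟨a, ha, rfl⟩ | ⟨⟨a, ha, rfl⟩, -⟩) | ⟨a, ha | ha, rfl⟩) <;> rw [hev]
    · exact hS.1 a (.inl ha)
    · exact hT.1 a (.inl ha)
    · exact hS.1 a (.inr ha)
    · exact hT.1 a (.inr ha)
  · rintro _ ⟨N, hN, rfl⟩ hsub
    rw [substSet, Set.image_image] at hsub
    simp only [hev] at hsub
    exact hN.elim (fun hN => hS.2 N hN hsub) (fun hN => hT.2 N hN hsub)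

/-! ### Sound derivations -/

/-- An infinite sequence of atomsets in which some steps apply a rule of `Rs`, with the
instantiation `τ n` of the skolemized rule; the applications are sound in the long run. -/
structure Deriv (Rs : Finset (Rule ar C V)) (F : Finset (Atom ar (Tm C V))) where
  A : ℕ → Set (Atom ar (SkTerm ar C V))
  pos : ℕ → Prop
  rule : ℕ → Rule ar C V
  τ : ℕ → V → SkTerm ar C V
  zero : A 0 = instSet SkTerm.null F
  step_pos : ∀ n, pos n → A (n + 1) = A n ∪ Atom.ev (τ n) '' (rule n).head
  step_neg : ∀ n, ¬ pos n → A (n + 1) = A n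
  mem : ∀ n, pos n → rule n ∈ Rs
  app : ∀ n, pos n → ∀ b ∈ (rule n).body, b.ev (τ n) ∈ A n
  new : ∀ n, pos n → ¬ Atom.ev (τ n) '' (rule n).head ⊆ A n
  sound : ∀ n, pos n → ∀ N ∈ (rule n).neg, ¬ Atom.ev (τ n) '' N ⊆ ⋃ k, A k
  sk : ∀ n, ∀ z ∈ (rule n).exist, τ n z = .skolem (rule n) z fun x => τ n x

/-- The atoms of the fact base and of the rules. -/
def templates (Rs : Finset (Rule ar C V)) (F : Finset (Atom ar (Tm C V))) :
    Set (Atom ar (Tm C V)) :=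
  F ∪ ⋃ R ∈ Rs, (R.body ∪ R.head ∪ ⋃ N ∈ R.neg, N : Set (Atom ar (Tm C V)))

/-- The constants and the nulls that can occur in a derivation. -/
def baseTerms (Rs : Finset (Rule ar C V)) (F : Finset (Atom ar (Tm C V))) : Set (SkTerm ar C V) :=
  Tm.inst SkTerm.null '' terms (templates Rs F)

theorem finite_templates (Rs : Finset (Rule ar C V)) (F : Finset (Atom ar (Tm C V))) :
    (templates Rs F).Finite :=
  F.finite_toSet.union <| Rs.finite_toSet.biUnion fun R _ =>
    (R.body.finite_toSet.union R.head.finite_toSet).union <|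
      R.neg.finite_toSet.biUnion fun N _ => N.finite_toSet

theorem finite_baseTerms (Rs : Finset (Rule ar C V)) (F : Finset (Atom ar (Tm C V))) :
    (baseTerms Rs F).Finite :=
  (finite_terms (finite_templates Rs F)).image _

theorem skolem_notMem_baseTerms {Rs : Finset (Rule ar C V)} {F : Finset (Atom ar (Tm C V))}
    (R : Rule ar C V) (z : V) (args : R.frontier → SkTerm ar C V) :
    SkTerm.skolem R z args ∉ baseTerms Rs F := by
  rintro ⟨t, -, ht⟩
  cases t <;> simp [Tm.inst] at ht

theorem head_subset_templates {Rs : Finset (Rule ar C V)} (F : Finset (Atom ar (Tm C V)))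
    {R : Rule ar C V} (hR : R ∈ Rs) {a : Atom ar (Tm C V)} (ha : a ∈ R.head) :
    a ∈ templates Rs F :=
  .inr <| Set.mem_biUnion (x := R) hR <| .inl <| .inr ha

theorem neg_subset_templates {Rs : Finset (Rule ar C V)} (F : Finset (Atom ar (Tm C V)))
    {R : Rule ar C V} (hR : R ∈ Rs) {N : Finset (Atom ar (Tm C V))} (hN : N ∈ R.neg)
    {a : Atom ar (Tm C V)} (ha : a ∈ N) : a ∈ templates Rs F :=
  .inr <| Set.mem_biUnion (x := R) hR <| .inr <| Set.mem_biUnion (x := N) hN ha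

theorem mem_frontier_or_exist {R : Rule ar C V} {h : Atom ar (Tm C V)} (hh : h ∈ R.head)
    {i : Fin (ar h.pred)} {v : V} (hv : h.args i = .var v) : v ∈ R.frontier ∨ v ∈ R.exist := by
  by_cases hb : v ∈ vars (R.body : Set (Atom ar (Tm C V)))
  · exact .inl ⟨hb, h, hh, i, hv⟩
  · exact .inr ⟨⟨h, hh, i, hv⟩, hb⟩

namespace Deriv

variable {Rs : Finset (Rule ar C V)} {F : Finset (Atom ar (Tm C V))} (D : Deriv Rs F)

/-- The atom `a` is produced at step `m`. -/
def Made (a : Atom ar (SkTerm ar C V)) (m : ℕ) : Prop := D.pos m ∧ a ∈ D.A (m + 1) ∧ a ∉ D.A m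

/-- The term `t` occurs after `n` steps. -/
def Occ (t : SkTerm ar C V) (n : ℕ) : Prop := t ∈ terms (D.A n)

/-- The functional term `t` is created at step `m`. -/
def Created (t : SkTerm ar C V) (m : ℕ) : Prop := D.pos m ∧ ∃ z ∈ (D.rule m).exist, t = D.τ m z

variable {D}

theorem subset_succ (n : ℕ) : D.A n ⊆ D.A (n + 1) := by
  by_cases h : D.pos n
  · rw [D.step_pos n h]; exact Set.subset_union_left
  · rw [D.step_neg n h]

theorem A_mono : Monotone D.A := monotone_nat_of_le_succ subset_succ

theorem Occ.mono {t : SkTerm ar C V} {m n : ℕ} (h : D.Occ t m) (hmn : m ≤ n) : D.Occ t n := by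
  obtain ⟨a, ha, i, hi⟩ := h
  exact ⟨a, A_mono hmn ha, i, hi⟩

theorem occ_of_body {n : ℕ} (hn : D.pos n) {b : Atom ar (Tm C V)} (hb : b ∈ (D.rule n).body)
    (i : Fin (ar b.pred)) : D.Occ ((b.args i).ev (D.τ n)) n :=
  ⟨_, D.app n hn b hb, i, rfl⟩

theorem occ_of_var {n : ℕ} (hn : D.pos n) {v : V}
    (hv : v ∈ vars ((D.rule n).body : Set (Atom ar (Tm C V)))) : D.Occ (D.τ n v) n := by
  obtain ⟨b, hb, i, hi⟩ := hv
  have := occ_of_body hn hb i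
  rwa [hi] at this

theorem mem_zero_or_made {a : Atom ar (SkTerm ar C V)} {n : ℕ} (h : a ∈ D.A n) :
    a ∈ D.A 0 ∨ ∃ m < n, D.Made a m := by
  induction n with
  | zero => exact .inl h
  | succ n ih =>
    by_cases ha : a ∈ D.A n
    · exact (ih ha).imp_right fun ⟨m, hm, h⟩ => ⟨m, hm.trans n.lt_succ_self, h⟩
    · by_cases hp : D.pos n
      · exact .inr ⟨n, n.lt_succ_self, hp, h, ha⟩
      · rw [D.step_neg n hp] at h; exact absurd h ha

theorem Made.exists_head {a : Atom ar (SkTerm ar C V)} {m : ℕ} (h : D.Made a m) :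
    ∃ h ∈ (D.rule m).head, h.ev (D.τ m) = a := by
  obtain ⟨hp, h1, h2⟩ := h
  rw [D.step_pos m hp] at h1
  exact h1.resolve_left h2

theorem Created.notMem_baseTerms {t : SkTerm ar C V} {m : ℕ} (h : D.Created t m) :
    t ∉ baseTerms Rs F := by
  obtain ⟨hp, z, hz, rfl⟩ := h
  rw [D.sk m z hz]
  exact skolem_notMem_baseTerms _ _ _

/-- A head term is a constant, an existential variable, or a frontier variable whose value already
occurs in the instantiated body. -/
theorem occ_cases {t : SkTerm ar C V} {n : ℕ} (h : D.Occ t n) :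
    t ∈ baseTerms Rs F ∨ ∃ k < n, D.Created t k := by
  induction n with
  | zero =>
    obtain ⟨a, ha, i, rfl⟩ := h
    rw [D.zero] at ha
    obtain ⟨f, hf, rfl⟩ := ha
    exact .inl ⟨_, ⟨f, .inl hf, i, rfl⟩, rfl⟩
  | succ n ih =>
    have ih' : D.Occ t n → t ∈ baseTerms Rs F ∨ ∃ k < n + 1, D.Created t k := fun h =>
      (ih h).imp_right fun ⟨k, hk, h⟩ => ⟨k, hk.trans n.lt_succ_self, h⟩
    obtain ⟨a, ha, i, rfl⟩ := h
    by_cases hp : D.pos n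
    · rw [D.step_pos n hp] at ha
      rcases ha with ha | ⟨h, hh, rfl⟩
      · exact ih' ⟨a, ha, i, rfl⟩
      · change (h.args i).ev (D.τ n) ∈ _ ∨ ∃ k < n + 1, D.Created ((h.args i).ev (D.τ n)) k
        change D.Occ ((h.args i).ev (D.τ n)) n → (h.args i).ev (D.τ n) ∈ _ ∨
          ∃ k < n + 1, D.Created ((h.args i).ev (D.τ n)) k at ih'
        cases hv : h.args i with
        | const c =>
          exact .inl ⟨.const c, ⟨h, head_subset_templates F (D.mem n hp) hh, i, hv⟩, rfl⟩
        | var v =>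
          rw [hv] at ih'
          rcases mem_frontier_or_exist hh hv with hf | he
          · exact ih' (occ_of_var hp hf.1)
          · exact .inr ⟨n, n.lt_succ_self, hp, v, he, rfl⟩
    · rw [D.step_neg n hp] at ha
      exact ih' ⟨a, ha, i, rfl⟩

/-- A functional term records its rule, its variable and the values of all frontier variables, and
these determine the whole instantiated head. -/
theorem head_eq_of_created {m k : ℕ} {z z' : V} (hz : z ∈ (D.rule m).exist)
    (hz' : z' ∈ (D.rule k).exist) (h : D.τ m z = D.τ k z') :
    z = z' ∧ Atom.ev (D.τ m) '' (D.rule m).head = Atom.ev (D.τ k) '' (D.rule k).head := by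
  have hm := D.sk m
  have hk := D.sk k
  rw [hm z hz, hk z' hz'] at h
  generalize D.rule m = R at *
  generalize D.rule k = R' at *
  simp only [SkTerm.skolem.injEq] at h
  obtain ⟨rfl, rfl, h⟩ := h
  have h := eq_of_heq h
  refine ⟨rfl, Set.image_congr fun a ha => Atom.ev_congr fun i w hw => ?_⟩
  rcases mem_frontier_or_exist ha hw with hf | he
  · exact congrFun h ⟨w, hf⟩
  · rw [hm w he, hk w he, h]

/-- Creating a term again would repeat a head instance that is already present, whereas every
positive step adds a new atom. -/
theorem Created.unique {t : SkTerm ar C V} {m k : ℕ} (hm : D.Created t m) (hk : D.Created t k) :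
    m = k := by
  have key : ∀ {m k : ℕ}, D.Created t m → D.Created t k → ¬ m < k := by
    rintro m k ⟨pm, z, hz, rfl⟩ ⟨pk, z', hz', h⟩ hlt
    refine D.new k pk ?_
    rw [← (head_eq_of_created hz hz' h).2]
    refine Set.Subset.trans ?_ (A_mono (Nat.succ_le_of_lt hlt))
    rw [Nat.succ_eq_add_one, D.step_pos m pm]
    exact Set.subset_union_right
  have h1 := key hm hk
  have h2 := key hk hm
  omega

theorem created_inj {m : ℕ} {z z' : V} (hz : z ∈ (D.rule m).exist) (hz' : z' ∈ (D.rule m).exist)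
    (h : D.τ m z = D.τ m z') : z = z' :=
  (head_eq_of_created hz hz' h).1

theorem Created.not_occ {t : SkTerm ar C V} {m : ℕ} (h : D.Created t m) : ¬ D.Occ t m := by
  intro ho
  rcases occ_cases ho with hb | ⟨k, hk, hc⟩
  · exact h.notMem_baseTerms hb
  · exact hk.ne (hc.unique h)

/-- An atom that contains a created term is produced after the creation of the term. -/
theorem Created.made {t : SkTerm ar C V} {m n : ℕ} (h : D.Created t m)
    {a : Atom ar (SkTerm ar C V)} (ha : a ∈ D.A n) {i : Fin (ar a.pred)} (hi : a.args i = t) :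
    ∃ k, m ≤ k ∧ k < n ∧ D.Made a k := by
  rcases mem_zero_or_made ha with h0 | ⟨k, hk, hm⟩
  · exact absurd (Occ.mono (D := D) ⟨a, h0, i, hi⟩ (Nat.zero_le m)) h.not_occ
  · refine ⟨k, ?_, hk, hm⟩
    by_contra hlt
    exact h.not_occ (Occ.mono (D := D) ⟨a, hm.2.1, i, hi⟩ (Nat.succ_le_of_lt (not_le.1 hlt)))

/-- A created term in the instantiated head of a later step is the image of a frontier variable. -/
theorem Created.frontier {t : SkTerm ar C V} {m k : ℕ} (h : D.Created t m) (hmk : m < k)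
    (hk : D.pos k) {a : Atom ar (Tm C V)} (ha : a ∈ (D.rule k).head) {i : Fin (ar a.pred)}
    (hi : (a.args i).ev (D.τ k) = t) :
    ∃ v ∈ (D.rule k).frontier, a.args i = .var v ∧ D.τ k v = t := by
  cases hv : a.args i with
  | const c =>
    rw [hv] at hi
    refine absurd ?_ h.notMem_baseTerms
    exact ⟨.const c, ⟨a, head_subset_templates F (D.mem k hk) ha, i, hv⟩, hi⟩
  | var v =>
    rw [hv] at hi
    rcases mem_frontier_or_exist ha hv with hf | he
    · exact ⟨v, hf, rfl, hi⟩
    · exact absurd (h.unique ⟨hk, v, he, hi.symm⟩) hmk.ne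

/-- A created term in the instantiated head of the step that creates it stands at an existential
position. -/
theorem created_position {m : ℕ} (hm : D.pos m) {z : V} (hz : z ∈ (D.rule m).exist)
    {a : Atom ar (Tm C V)} (ha : a ∈ (D.rule m).head) {i : Fin (ar a.pred)}
    (hi : (a.args i).ev (D.τ m) = D.τ m z) : a.args i = .var z := by
  have h : D.Created (D.τ m z) m := ⟨hm, z, hz, rfl⟩
  cases hv : a.args i with
  | const c =>
    rw [hv] at hi
    refine absurd ?_ h.notMem_baseTerms
    exact ⟨.const c, ⟨a, head_subset_templates F (D.mem m hm) ha, i, hv⟩, hi⟩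
  | var v =>
    rw [hv] at hi
    rcases mem_frontier_or_exist ha hv with hf | he
    · exact absurd (hi ▸ occ_of_var hm hf.1) h.not_occ
    · rw [created_inj he hz hi]

/-- Soundness refers to the union of all stages, so that rules applied at different steps are
realised in one and the same atomset and can be composed. -/
theorem realised_copy {n : ℕ} (hn : D.pos n) (j : ℕ) {σ : ℕ × V → SkTerm ar C V}
    (hσ : ∀ v, σ (j, v) = D.τ n v) : ((D.rule n).copy j).Realised σ (⋃ k, D.A k) := by
  have hev : ∀ a : Atom ar (Tm C V), (a.subst (ren j)).ev σ = a.ev (D.τ n) := fun a => by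
    rw [Atom.ev_subst]
    congr 1
    funext v
    exact hσ v
  refine ⟨?_, ?_⟩
  · rw [Rule.headAtoms_copy]
    rintro _ (⟨b, hb, rfl⟩ | ⟨h, hh, rfl⟩)
    · rw [hev]; exact Set.mem_iUnion.2 ⟨n, D.app n hn b hb⟩
    · rw [hev]
      refine Set.mem_iUnion.2 ⟨n + 1, ?_⟩
      rw [D.step_pos n hn]
      exact .inr ⟨h, hh, rfl⟩
  · rintro _ ⟨N, hN, rfl⟩ hsub
    rw [substSet, Set.image_image] at hsub
    simp only [hev] at hsub
    exact D.sound n hn N hN hsub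

/-! ### Dependencies between the steps of a derivation -/

/-- The instantiation of two rules that are renamed apart. -/
def pair (σ τ : V → SkTerm ar C V) : ℕ × V → SkTerm ar C V :=
  fun w => if w.1 = 0 then σ w.2 else τ w.2

theorem ev_pair_zero (σ τ : V → SkTerm ar C V) (a : Atom ar (Tm C V)) :
    (a.subst (ren 0)).ev (pair σ τ) = a.ev σ := by
  rw [Atom.ev_subst]; congr 1

theorem ev_pair_one (σ τ : V → SkTerm ar C V) (a : Atom ar (Tm C V)) :
    (a.subst (ren 1)).ev (pair σ τ) = a.ev τ := by
  rw [Atom.ev_subst]; congr 1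

theorem not_selfBlocking {m n : ℕ} (hm : D.pos m) (hn : D.pos n) {μ : ℕ × V → Tm C (ℕ × V)}
    (hμ : ∀ w, (μ w).ev (pair (D.τ m) (D.τ n)) = pair (D.τ m) (D.τ n) w) :
    ¬ (((D.rule m).copy 0).comp ((D.rule n).copy 1) μ).SelfBlocking :=
  ((realised_copy hm 0 fun _ => rfl).comp (realised_copy hn 1 fun _ => rfl) hμ).not_selfBlocking

theorem exists_ren_of_args {j : ℕ} {a : Atom ar (Tm C V)} {i : Fin (ar a.pred)} {w : ℕ × V}
    (h : (a.subst (ren j)).args i = .var w) : ∃ v, a.args i = .var v ∧ w = (j, v) := by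
  change (a.args i).subst (ren j) = .var w at h
  cases hv : a.args i with
  | const c => rw [hv] at h; cases h
  | var v => rw [hv] at h; exact ⟨v, rfl, by simpa [Tm.subst, ren] using h.symm⟩

/-- If step `n` uses an atom that step `m` produces, and the terms created at step `m` for variables
outside of `T` occur at step `n` only in atoms produced at step `m`, then this is witnessed by a
piece-unifier. -/
theorem exists_pieceUnifies {m n : ℕ} (hm : D.pos m) (hn : D.pos n) {b₀ h₀ : Atom ar (Tm C V)}
    (hb₀ : b₀ ∈ (D.rule n).body) (hh₀ : h₀ ∈ (D.rule m).head)
    (he : h₀.ev (D.τ m) = b₀.ev (D.τ n)) (hmade : D.Made (b₀.ev (D.τ n)) m) {T : Set V}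
    (hT : ∀ b ∈ (D.rule n).body, ¬ D.Made (b.ev (D.τ n)) m → ∀ i, ∀ z ∈ (D.rule m).exist, z ∉ T →
      (b.args i).ev (D.τ n) ≠ D.τ m z) :
    ∃ B' H' μ, PieceUnifies (D.rule m) T (D.rule n) B' H' μ ∧ b₀.subst (ren 1) ∈ B' ∧
      h₀.subst (ren 0) ∈ H' ∧ (h₀.subst (ren 0)).subst μ = (b₀.subst (ren 1)).subst μ := by
  classical
  set σ := pair (D.τ m) (D.τ n) with hσ
  -- All body atoms produced at step `m` are unified at once; a separating variable then occurs in
  -- an atom not produced there, to which `hT` applies.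
  let B₀ : Set (Atom ar (Tm C V)) := {b | b ∈ (D.rule n).body ∧ D.Made (b.ev (D.τ n)) m}
  -- `g` chooses by value the head atom from which a produced atom stems, with the choice `h₀`
  -- prescribed for the value of `b₀`.
  have hg : ∃ g : Atom ar (SkTerm ar C V) → Atom ar (Tm C V), g (b₀.ev (D.τ n)) = h₀ ∧
      ∀ b ∈ B₀, g (b.ev (D.τ n)) ∈ (D.rule m).head ∧
        (g (b.ev (D.τ n))).ev (D.τ m) = b.ev (D.τ n) := by
    refine ⟨fun a => if a = b₀.ev (D.τ n) then h₀ else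
      if h : D.Made a m then h.exists_head.choose else h₀, if_pos rfl, fun b hb => ?_⟩
    by_cases h : b.ev (D.τ n) = b₀.ev (D.τ n)
    · simp only [h, if_true]
      exact ⟨hh₀, he⟩
    · simp only [h, if_false, hb.2, dif_pos]
      exact hb.2.exists_head.choose_spec
  obtain ⟨g, hg₀, hg⟩ := hg
  have hb₀' : b₀ ∈ B₀ := ⟨hb₀, hmade⟩
  let H₀ : Set (Atom ar (Tm C V)) := (fun b => g (b.ev (D.τ n))) '' B₀
  have fB₀ : B₀.Finite := (D.rule n).body.finite_toSet.subset fun b hb => hb.1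
  have hH₀ : H₀ ⊆ (D.rule m).head := by
    rintro _ ⟨b, hb, rfl⟩
    exact (hg b hb).1
  have hval : Atom.ev σ '' substSet (ren 1) B₀ = Atom.ev σ '' substSet (ren 0) H₀ := by
    simp only [substSet, H₀, Set.image_image, hσ, ev_pair_zero, ev_pair_one]
    exact Set.image_congr fun b hb => ((hg b hb).2).symm
  obtain ⟨μ, hμ, hfac⟩ := exists_unifier (B := ((D.rule n).copy 1).body)
    (H := ((D.rule m).copy 0).headAtoms) (Set.image_mono fun b hb => hb.1)
    (by rw [Rule.headAtoms_copy]; exact Set.image_mono hH₀)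
    (fB₀.image _) ((fB₀.image _).image _) σ hval
  have hh₀' : h₀ ∈ H₀ := ⟨b₀, hb₀', hg₀⟩
  have hev : ∀ a : Atom ar (Tm C (ℕ × V)), (a.subst μ).ev σ = a.ev σ := fun a => by
    rw [Atom.ev_subst]; congr 1; funext w; exact hfac w
  refine ⟨_, _, μ, ⟨⟨hμ, ?_⟩, not_selfBlocking hm hn hfac⟩, ⟨b₀, hb₀', rfl⟩, ⟨h₀, hh₀', rfl⟩, ?_⟩
  · rintro x ⟨-, _, ⟨⟨b, hb, rfl⟩, hbB⟩, i, hi⟩ _ ⟨-, z, ⟨hz, hzT⟩, rfl⟩ hxz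
    obtain ⟨v, hv, rfl⟩ := exists_ren_of_args hi
    refine hT b hb (fun hmd => hbB ⟨b, ⟨hb, hmd⟩, rfl⟩) i z hz hzT ?_
    have := congrArg (Tm.ev σ) hxz
    rw [hfac, hfac] at this
    rw [hv]
    exact this
  -- The unifier equates sets only. Comparing ground values shows that the head atom matched with
  -- `b₀` was chosen for the value of `b₀`, so it is `h₀`.
  · have : (b₀.subst (ren 1)).subst μ ∈ substSet μ (substSet (ren 0) H₀) :=
      hμ.unifies ▸ ⟨_, ⟨b₀, hb₀', rfl⟩, rfl⟩
    obtain ⟨_, ⟨_, ⟨b, hb, rfl⟩, rfl⟩, hbe⟩ := this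
    have h1 := congrArg (Atom.ev σ) hbe
    rw [hev, hev, hσ, ev_pair_zero, ev_pair_one] at h1
    have h2 : b.ev (D.τ n) = b₀.ev (D.τ n) := (hg b hb).2.symm.trans h1
    simp only [h2, hg₀] at hbe
    exact hbe

/-- Unifying nothing is allowed along agglomeration paths; it prolongs a path without changing the
agglomerated rule. -/
theorem pieceUnifies_empty {m n : ℕ} (hm : D.pos m) (hn : D.pos n) (T : Set V) :
    PieceUnifies (D.rule m) T (D.rule n) ∅ ∅ Tm.var := by
  refine ⟨⟨⟨Set.empty_subset _, Set.empty_subset _, fun _ _ => rfl, fun w hw => ?_, ?_, ?_⟩, ?_⟩,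
    not_selfBlocking hm hn fun _ => rfl⟩
  · simp [vars] at hw
  · simp [substSet]
  · rintro ν - -
    exact ⟨ν, fun w _ => rfl⟩
  · rintro x ⟨hx, -⟩
    simp [vars] at hx

variable (D) in
/-- The edges of the graph of rule dependencies between rules that are applied. -/
def Dep (R R' : Rule ar C V) : Prop :=
  Depends R R' ∧ (∃ m, D.pos m ∧ D.rule m = R) ∧ ∃ n, D.pos n ∧ D.rule n = R'

/-- If the piece condition fails for `m` and `n`, a term created at `m` reaches `n` in an atom
produced at some `m'` strictly in between. The rule of `m'` has this term in its instantiated body,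
so it depends on that of `m` by induction on `n`, and the rule of `n` depends on that of `m'` by
induction on `n - m`. -/
theorem transGen_dep_aux (n : ℕ) (hn : D.pos n) :
    (∀ b ∈ (D.rule n).body, ∀ m, m < n → D.Made (b.ev (D.τ n)) m →
      Relation.TransGen D.Dep (D.rule m) (D.rule n)) ∧
    (∀ t m, D.Created t m →
      ∀ b ∈ (D.rule n).body, ∀ i, (b.args i).ev (D.τ n) = t →
      Relation.TransGen D.Dep (D.rule m) (D.rule n)) := by
  induction n using Nat.strong_induction_on with
  | _ n ih =>
    have later : ∀ t m m' (a : Atom ar (SkTerm ar C V)) i, D.Created t m → D.Made a m' →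
        a.args i = t → m < m' → m' < n → Relation.TransGen D.Dep (D.rule m) (D.rule m') := by
      intro t m m' a i hc hmade hi hlt hlt'
      obtain ⟨h, hh, rfl⟩ := hmade.exists_head
      obtain ⟨v, hv, -, hvt⟩ := hc.frontier hlt hmade.1 hh hi
      obtain ⟨b, hb, j, hj⟩ := hv.1
      exact (ih m' hlt' hmade.1).2 t m hc b hb j
        (by rw [hj]; exact hvt)
    have first : ∀ k, ∀ m, n - m = k → ∀ b ∈ (D.rule n).body, m < n → D.Made (b.ev (D.τ n)) m →
        Relation.TransGen D.Dep (D.rule m) (D.rule n) := by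
      intro k
      induction k using Nat.strong_induction_on with
      | _ k ihk =>
        rintro m rfl b hb hmn hmade
        by_cases hT : ∀ b ∈ (D.rule n).body, ¬ D.Made (b.ev (D.τ n)) m → ∀ i,
            ∀ z ∈ (D.rule m).exist, z ∉ (∅ : Set V) → (b.args i).ev (D.τ n) ≠ D.τ m z
        · obtain ⟨h, hh, he⟩ := hmade.exists_head
          obtain ⟨B', H', μ, hp, hB, -⟩ := exists_pieceUnifies hmade.1 hn hb hh he hmade hT
          exact .single ⟨⟨B', H', μ, ⟨_, hB⟩, hp⟩, ⟨m, hmade.1, rfl⟩, ⟨n, hn, rfl⟩⟩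
        · push Not at hT
          obtain ⟨b', hb', hnm, i, z, hz, -, hbz⟩ := hT
          have hc : D.Created (D.τ m z) m := ⟨hmade.1, z, hz, rfl⟩
          obtain ⟨m', hle, hlt, hmade'⟩ := hc.made (D.app n hn b' hb') (i := i) hbz
          have hlt' : m < m' := lt_of_le_of_ne hle fun h => hnm (h ▸ hmade')
          exact (later _ m m' (b'.ev (D.τ n)) i hc hmade' hbz hlt' hlt).trans
            (ihk (n - m') (by omega) m' rfl b' hb' hlt hmade')
    refine ⟨fun b hb m hmn hmade => first _ m rfl b hb hmn hmade, ?_⟩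
    intro t m hc b hb i hi
    obtain ⟨m', hle, hlt, hmade⟩ := hc.made (D.app n hn b hb) (i := i) hi
    rcases hle.eq_or_lt with rfl | hlt'
    · exact first _ _ rfl b hb hlt hmade
    · exact (later t m m' (b.ev (D.τ n)) i hc hmade hi hlt' hlt).trans (first _ _ rfl b hb hlt hmade)

theorem Made.lt {n m : ℕ} {a : Atom ar (SkTerm ar C V)} (h : D.Made a m) (ha : a ∈ D.A n) :
    m < n := by
  by_contra hlt
  exact h.2.2 (A_mono (not_lt.1 hlt) ha)

/-- The rule of a step depends, possibly indirectly, on the rules that produce the atoms it uses. -/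
theorem Made.transGen {m n : ℕ} (hn : D.pos n) {b : Atom ar (Tm C V)} (hb : b ∈ (D.rule n).body)
    (h : D.Made (b.ev (D.τ n)) m) : Relation.TransGen D.Dep (D.rule m) (D.rule n) :=
  (transGen_dep_aux n hn).1 b hb m (h.lt (D.app n hn b hb)) h

/-- The rule of a step depends, possibly indirectly, on the rules that create the terms it uses. -/
theorem Created.transGen {t : SkTerm ar C V} {m n : ℕ} (h : D.Created t m) (hn : D.pos n)
    {b : Atom ar (Tm C V)} (hb : b ∈ (D.rule n).body) {i : Fin (ar b.pred)}
    (hi : (b.args i).ev (D.τ n) = t) : Relation.TransGen D.Dep (D.rule m) (D.rule n) :=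
  (transGen_dep_aux n hn).2 t m h b hb i hi

/-- The atom in which a created term reaches step `n` is produced at the step that creates the term,
or at a later one, in which the term is the image of a frontier variable. -/
theorem Created.trace {t : SkTerm ar C V} {m n : ℕ} (h : D.Created t m) (hn : D.pos n)
    {b : Atom ar (Tm C V)} (hb : b ∈ (D.rule n).body) {i : Fin (ar b.pred)}
    (hi : (b.args i).ev (D.τ n) = t) :
    ∃ k < n, D.Made (b.ev (D.τ n)) k ∧ ∃ a ∈ (D.rule k).head, a.ev (D.τ k) = b.ev (D.τ n) ∧
      ∃ j : Fin (ar a.pred), (j : ℕ) = i ∧ ((k = m ∧ ∃ z ∈ (D.rule m).exist, a.args j = .var z ∧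
          t = D.τ m z) ∨
        (m < k ∧ ∃ v ∈ (D.rule k).frontier, a.args j = .var v ∧ ∃ b' ∈ (D.rule k).body,
          ∃ i', b'.args i' = .var v ∧ (b'.args i').ev (D.τ k) = t)) := by
  obtain ⟨k, hle, hlt, hmade⟩ := h.made (D.app n hn b hb) (i := i) hi
  obtain ⟨a, ha, he⟩ := hmade.exists_head
  obtain ⟨hp, hargs⟩ := Atom.map_eq_map he
  refine ⟨k, hlt, hmade, a, ha, he, Fin.cast (congrArg ar hp.symm) i, rfl, ?_⟩
  have hat := (hargs (Fin.cast (congrArg ar hp.symm) i) i rfl).trans hi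
  rcases hle.eq_or_lt with rfl | hlt'
  · obtain ⟨hm, z, hz, rfl⟩ := h
    exact .inl ⟨rfl, z, hz, created_position hm hz ha hat, rfl⟩
  · obtain ⟨v, hv, hav, hvt⟩ := h.frontier hlt' hmade.1 ha hat
    obtain ⟨b', hb', i', hi'⟩ := hv.1
    exact .inr ⟨hlt', v, hv, hav, b', hb', i', hi', by rw [hi']; exact hvt⟩

end Deriv

/-! ### Agglomerated rules and transition edges. -/

theorem AggPath.subset {Rs : Finset (Rule ar C V)} {R R' : Rule ar C V} {T : Set V}
    (h : AggPath Rs R R' T) : T ⊆ vars (R.head : Set (Atom ar (Tm C V))) := by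
  induction h with
  | nil => exact Set.empty_subset _
  | step _ _ _ hp ih =>
    refine Set.union_subset ih ?_
    rintro v ⟨a, ha, i, hi⟩
    have := hp.1.1.head_sub ha
    rw [Rule.headAtoms_copy] at this
    obtain ⟨h, hh, rfl⟩ := this
    obtain ⟨w, hw, he⟩ := Deriv.exists_ren_of_args hi
    exact ⟨h, hh, i, by rw [hw, (Prod.mk.inj he).2]⟩

theorem finite_vars {W : Type*} {A : Set (Atom ar (Tm C W))} (hA : A.Finite) : (vars A).Finite :=
  (finite_terms hA).preimage (f := Tm.var) fun _ _ _ _ h => Tm.var.inj h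

/-- Among the agglomerated rules associated with closed paths there is a largest one. -/
theorem exists_maximal_aggPath {Rs : Finset (Rule ar C V)} {R : Rule ar C V} (hR : R ∈ Rs) :
    ∃ T, AggPath Rs R R T ∧ ∀ T', AggPath Rs R R T' → T ⊆ T' → T' ⊆ T := by
  have hfin : {T | AggPath Rs R R T}.Finite :=
    ((finite_vars R.head.finite_toSet).finite_subsets).subset fun T hT => hT.subset
  obtain ⟨T, hT, hmax⟩ := hfin.exists_maximal ⟨∅, AggPath.nil hR⟩
  exact ⟨T, hT, fun T' hT' h => hmax hT' h⟩

namespace Deriv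

variable {Rs : Finset (Rule ar C V)} {F : Finset (Atom ar (Tm C V))} {D : Deriv Rs F}

variable (D) in
/-- Reachability in the graph of rule dependencies between rules that are applied. -/
def Reach : Rule ar C V → Rule ar C V → Prop := Relation.ReflTransGen D.Dep

theorem extend_aggPath {m : ℕ} (hm : D.pos m) {X Y : Rule ar C V} {T : Set V}
    (h : AggPath Rs (D.rule m) X T) (hXY : D.Reach X Y) : AggPath Rs (D.rule m) Y T := by
  induction hXY with
  | refl => exact h
  | tail _ hd ih =>
    obtain ⟨hdep, -, n, hn, rfl⟩ := hd
    have := AggPath.step ih (D.mem n hn) hdep (pieceUnifies_empty hm hn T)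
    simpa [vars] using this

/-- If the term arrives in an atom produced after `m`, the producing step uses it too, and induction
applies. If it arrives in an atom produced at `m`, the same argument puts all variables violating
the piece condition into `T`. So the closed path through the rule of `n` can unify `z`, and
maximality of `T` yields `z ∈ T`. -/
theorem mem_maximal {m : ℕ} (hm : D.pos m) {T : Set V}
    (hT : AggPath Rs (D.rule m) (D.rule m) T)
    (hmax : ∀ T', AggPath Rs (D.rule m) (D.rule m) T' → T ⊆ T' → T' ⊆ T)
    (n : ℕ) (hn : D.pos n) (hr : D.Reach (D.rule n) (D.rule m)) {z : V}
    (hz : z ∈ (D.rule m).exist) {b : Atom ar (Tm C V)} (hb : b ∈ (D.rule n).body)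
    {i : Fin (ar b.pred)} (hi : (b.args i).ev (D.τ n) = D.τ m z) : z ∈ T := by
  induction n using Nat.strong_induction_on generalizing z b with
  | _ n ih =>
    have hc : ∀ z ∈ (D.rule m).exist, D.Created (D.τ m z) m := fun z hz => ⟨hm, z, hz, rfl⟩
    have later : ∀ z ∈ (D.rule m).exist, ∀ b ∈ (D.rule n).body, ∀ i, ∀ k < n,
        D.Made (b.ev (D.τ n)) k → m < k → (b.args i).ev (D.τ n) = D.τ m z → z ∈ T := by
      intro z hz b hb i k hkn hmade hlt hi
      obtain ⟨k', hk', hmade', a, ha, he, j, -, ⟨rfl, -⟩ | ⟨hlt', v, hv, -, b', hb', i', -, hi'⟩⟩ :=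
        (hc z hz).trace hn hb hi
      · have hk : k < k' + 1 := hmade.lt hmade'.2.1
        omega
      · exact ih k' hk' hmade'.1 ((hmade'.transGen hn hb).to_reflTransGen.trans hr) hz hb' hi'
    obtain ⟨k, hkn, hmade, a, ha, he, j, -, ⟨rfl, z', hz', haz, hzz⟩ | ⟨hlt, -⟩⟩ :=
      (hc z hz).trace hn hb hi
    · obtain rfl := created_inj hz hz' hzz
      obtain ⟨B', H', μ, hp, -, hH, -⟩ := exists_pieceUnifies (T := T) hm hn hb ha he hmade (by
        intro b' hb' hnm i' z' hz' hzT hbz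
        obtain ⟨k', hle, hlt, hmade'⟩ := (hc z' hz').made (D.app n hn b' hb') (i := i') hbz
        exact hzT (later z' hz' b' hb' i' k' hlt hmade'
          (lt_of_le_of_ne hle fun h => hnm (h ▸ hmade')) hbz))
      obtain ⟨X, hX, hd⟩ := Relation.TransGen.tail'_iff.1 (hmade.transGen hn hb)
      -- Go from `m` to a direct predecessor of `n`, unify at `n`, then return to `m` with empty
      -- unifiers.
      have h1 := AggPath.step (extend_aggPath hm hT hX) (D.mem n hn) hd.1 hp
      refine hmax _ (extend_aggPath hm h1 hr) Set.subset_union_left (.inr ?_)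
      exact ⟨_, hH, j, by change (a.args j).subst (ren 0) = _; rw [haz]; rfl⟩
    · exact later z hz b hb i k hkn hmade hlt hi

/-- If the rules of two steps are in the same component of the graph of rule dependencies, then the
use of an atom is reflected by transition edges. -/
theorem transitionEdge {m n : ℕ} (hn : D.pos n) {p q : Pos ar C V}
    (hp : p.IsHead Rs) (hpm : p.rule = D.rule m) (hq : q.IsBody Rs) (hqn : q.rule = D.rule n)
    (he : p.atom.ev (D.τ m) = q.atom.ev (D.τ n)) (hmade : D.Made (q.atom.ev (D.τ n)) m)
    (hidx : (p.idx : ℕ) = q.idx) (hr : D.Reach (D.rule n) (D.rule m)) :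
    TransitionEdge Rs p q := by
  have hm := hmade.1
  have hpa := hp.2.2
  have hqa := hq.2.2
  rw [hpm] at hpa
  rw [hqn] at hqa
  obtain ⟨T, hT, hmax⟩ := exists_maximal_aggPath (D.mem m hm)
  obtain ⟨B', H', μ, hpu, -, -, heq⟩ := exists_pieceUnifies (T := T) hm hn hqa hpa he hmade (by
    intro b hb _ i z hz hzT hbz
    exact hzT (mem_maximal hm hT hmax n hn hr hz hb hbz))
  obtain ⟨X, hX, hd⟩ := Relation.TransGen.tail'_iff.1 (hmade.transGen hn hqa)
  refine ⟨hp, hq, (Atom.map_eq_map he).1, hidx, T, B', H', μ, ?_, ?_, ?_⟩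
  · refine ⟨{(X, T)}, Set.singleton_nonempty _, ?_, by simp⟩
    rintro _ rfl
    rw [hpm, hqn]
    exact ⟨extend_aggPath hm hT hX, hd.1⟩
  · rw [hpm, hqn]
    exact hpu
  · have h1 : ((p.atom.subst (ren 0)).subst μ) = ((q.atom.subst (ren 1)).subst μ) := heq
    rw [Atom.subst_subst, Atom.subst_subst] at h1
    have h2 := (Atom.map_eq_map h1).2 p.idx q.idx hidx
    rw [Tm.subst_subst, Tm.subst_subst]
    exact h2

theorem frontier_disjoint_exist {R : Rule ar C V} {v : V} (h : v ∈ R.frontier) : v ∉ R.exist :=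
  fun h' => h'.2 h.1

/-- A created term propagates along a path of the position graph without further existential
positions. -/
theorem Created.exists_path {t : SkTerm ar C V} {m : ℕ} (h : D.Created t m) (n : ℕ)
    (hn : D.pos n) {b : Atom ar (Tm C V)} (hb : b ∈ (D.rule n).body) {i : Fin (ar b.pred)}
    (hi : (b.args i).ev (D.τ n) = t) (hr : D.Reach (D.rule n) (D.rule m)) :
    ∃ a ∈ (D.rule m).head, ∃ j, ∃ z ∈ (D.rule m).exist, a.args j = .var z ∧ t = D.τ m z ∧
      Relation.TransGen (fun x y => Edge Rs x y ∧ ¬ y.IsExistential Rs)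
        ⟨D.rule m, true, a, j⟩ ⟨D.rule n, false, b, i⟩ := by
  induction n using Nat.strong_induction_on generalizing b with
  | _ n ih =>
    have hbody : ∀ {n b i}, D.pos n → b ∈ (D.rule n).body →
        (⟨D.rule n, false, b, i⟩ : Pos ar C V).IsBody Rs := fun hn hb => ⟨D.mem _ hn, rfl, hb⟩
    have hnex : ¬ (⟨D.rule n, false, b, i⟩ : Pos ar C V).IsExistential Rs :=
      fun hx => absurd hx.1.2.1 Bool.false_ne_true
    obtain ⟨k, hkn, hmade, a, ha, he, j, hj, hcase⟩ := h.trace hn hb hi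
    have hhead : (⟨D.rule k, true, a, j⟩ : Pos ar C V).IsHead Rs := ⟨D.mem k hmade.1, rfl, ha⟩
    have hkn' := hmade.transGen hn hb
    rcases hcase with ⟨rfl, z, hz, haz, htz⟩ | ⟨hlt, v, hv, hav, b', hb', i', hbv, hi'⟩
    · exact ⟨a, ha, j, z, hz, haz, htz,
        .single ⟨.inr (transitionEdge hn hhead rfl (hbody hn hb) rfl he hmade hj hr), hnex⟩⟩
    · obtain ⟨a', ha', j', z, hz, haz, htz, hpath⟩ := ih k hkn hmade.1 hb' hi'
        (hkn'.to_reflTransGen.trans hr)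
      have hmk := (h.transGen hmade.1 hb' hi').to_reflTransGen
      refine ⟨a', ha', j', z, hz, haz, htz, (hpath.tail (b := _) (c := ⟨D.rule k, true, a, j⟩)
        ⟨.inl ⟨hbody hmade.1 hb', hhead, rfl, ⟨v, hv, hbv⟩, .inl ?_⟩, ?_⟩).tail
        ⟨.inr (transitionEdge hn hhead rfl (hbody hn hb) rfl he hmade hj (hr.trans hmk)), hnex⟩⟩
      · exact hbv.trans hav.symm
      · rintro ⟨-, w, hw, hwv⟩
        obtain rfl := Tm.var.inj (hav.symm.trans hwv)
        exact frontier_disjoint_exist hv hw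

/-! ### Routes of created terms through head positions. -/

variable (D) in
/-- The atom at the head position `x.2` of step `x.1` is used at the position `q` of step `y.1`, from
which the position graph of the rule leads to the head position `y.2`. -/
def Link (x : ℕ × Pos ar C V) (q : Pos ar C V) (y : ℕ × Pos ar C V) : Prop :=
  x.2.IsHead Rs ∧ x.2.rule = D.rule x.1 ∧ q.rule = D.rule y.1 ∧ D.pos y.1 ∧
    x.2.atom.ev (D.τ x.1) = q.atom.ev (D.τ y.1) ∧ D.Made (q.atom.ev (D.τ y.1)) x.1 ∧
    (x.2.idx : ℕ) = q.idx ∧ InternalEdge Rs q y.2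

variable (D) in
/-- Some position links the two head positions. -/
def Linked (x y : ℕ × Pos ar C V) : Prop := ∃ q, D.Link x q y

/-- Unlike `Created.exists_path`, this does not require that the two rules reach each other. Links
record only what happens in the derivation; they become transition edges once the walk is closed. -/
theorem Created.exists_linked {t : SkTerm ar C V} {m : ℕ} (h : D.Created t m) (n : ℕ)
    (hn : D.pos n) {b : Atom ar (Tm C V)} (hb : b ∈ (D.rule n).body) {i : Fin (ar b.pred)}
    (hi : (b.args i).ev (D.τ n) = t) {r : Pos ar C V}
    (hr : InternalEdge Rs ⟨D.rule n, false, b, i⟩ r) :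
    ∃ p : Pos ar C V, p.rule = D.rule m ∧ p.IsExistential Rs ∧
      Relation.TransGen D.Linked (m, p) (n, r) := by
  induction n using Nat.strong_induction_on generalizing b r with
  | _ n ih =>
    obtain ⟨k, hkn, hmade, a, ha, he, j, hj, hcase⟩ := h.trace hn hb hi
    have hhead : (⟨D.rule k, true, a, j⟩ : Pos ar C V).IsHead Rs := ⟨D.mem k hmade.1, rfl, ha⟩
    have hlink : D.Linked (k, ⟨D.rule k, true, a, j⟩) (n, r) :=
      ⟨⟨D.rule n, false, b, i⟩, hhead, rfl, rfl, hn, he, hmade, hj, hr⟩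
    rcases hcase with ⟨rfl, z, hz, haz, htz⟩ | ⟨hlt, v, hv, hav, b', hb', i', hbv, hi'⟩
    · exact ⟨_, rfl, ⟨hhead, z, hz, haz⟩, .single hlink⟩
    · obtain ⟨p, hp, hex, hpath⟩ := ih k hkn hmade.1 hb' hi' (r := ⟨D.rule k, true, a, j⟩)
        ⟨⟨D.mem k hmade.1, rfl, hb'⟩, hhead, rfl, ⟨v, hv, hbv⟩, .inl (hbv.trans hav.symm)⟩
      exact ⟨p, hp, hex, hpath.tail hlink⟩

end Deriv

/-! ### Nesting depth and recurrence of existential positions. -/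

/-- The terms of nesting depth at most `d`. -/
def boundedTerms (Rs : Finset (Rule ar C V)) (F : Finset (Atom ar (Tm C V))) :
    ℕ → Set (SkTerm ar C V)
  | 0 => baseTerms Rs F
  | d + 1 => baseTerms Rs F ∪
      ⋃ R ∈ Rs, ⋃ z ∈ R.exist, SkTerm.skolem R z '' {args | ∀ x, args x ∈ boundedTerms Rs F d}

theorem baseTerms_subset (Rs : Finset (Rule ar C V)) (F : Finset (Atom ar (Tm C V))) (d : ℕ) :
    baseTerms Rs F ⊆ boundedTerms Rs F d := by
  cases d with
  | zero => exact subset_rfl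
  | succ d => exact Set.subset_union_left

theorem finite_boundedTerms (Rs : Finset (Rule ar C V)) (F : Finset (Atom ar (Tm C V))) (d : ℕ) :
    (boundedTerms Rs F d).Finite := by
  induction d with
  | zero => exact finite_baseTerms Rs F
  | succ d ih =>
    refine (finite_baseTerms Rs F).union <| Rs.finite_toSet.biUnion fun R _ =>
      ((finite_vars R.head.finite_toSet).subset Set.sdiff_subset).biUnion fun z _ => ?_
    have : Finite R.frontier :=
      ((finite_vars R.head.finite_toSet).subset Set.inter_subset_right).to_subtype
    refine Set.Finite.image _ ?_
    exact (Set.Finite.pi' fun _ => ih)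

/-- The finitely many existential positions. -/
theorem finite_existential (Rs : Finset (Rule ar C V)) :
    {p : Pos ar C V | p.IsExistential Rs}.Finite := by
  refine Set.Finite.subset (s := ⋃ R ∈ Rs, ⋃ a ∈ R.head,
    Set.range fun i => (⟨R, true, a, i⟩ : Pos ar C V)) ?_ ?_
  · exact Rs.finite_toSet.biUnion fun R _ => R.head.finite_toSet.biUnion fun a _ =>
      Set.finite_range _
  · rintro ⟨R, hd, a, i⟩ ⟨⟨hR, hh, ha⟩, -⟩
    obtain rfl : hd = true := hh
    exact Set.mem_biUnion (x := R) hR (Set.mem_biUnion (x := a) ha ⟨i, rfl⟩)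

namespace Deriv

variable {Rs : Finset (Rule ar C V)} {F : Finset (Atom ar (Tm C V))} {D : Deriv Rs F}

/-- A functional term outside depth `d + 1` has an argument outside depth `d`, which was itself
created. The sequence `s` thus runs backwards in time, and only its first `d` links are meaningful.
-/
theorem exists_chain (d : ℕ) : ∀ (t : SkTerm ar C V) (n : ℕ), t ∉ boundedTerms Rs F d →
    D.Created t n → ∀ p : Pos ar C V, p.rule = D.rule n → p.IsExistential Rs →
    ∃ s : ℕ → ℕ × Pos ar C V, s 0 = (n, p) ∧ (∀ i, (s i).2.IsExistential Rs) ∧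
      ∀ i < d, Relation.TransGen D.Linked (s (i + 1)) (s i) := by
  induction d with
  | zero =>
    intro t n _ _ p _ hex
    exact ⟨fun _ => (n, p), rfl, fun _ => hex, fun i hi => absurd hi (Nat.not_lt_zero i)⟩
  | succ d ih =>
    rintro t n hd ⟨hn, z, hz, rfl⟩ p hp hex
    have : ∃ x : (D.rule n).frontier, D.τ n x ∉ boundedTerms Rs F d := by
      by_contra! hall
      refine hd (.inr (Set.mem_biUnion (x := D.rule n) (D.mem n hn)
        (Set.mem_biUnion (x := z) hz ⟨_, hall, (D.sk n z hz).symm⟩)))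
    obtain ⟨⟨x, hx⟩, hxd⟩ := this
    rcases occ_cases (occ_of_var hn hx.1) with hb | ⟨k, -, hc⟩
    · exact absurd (baseTerms_subset Rs F d hb) hxd
    · obtain ⟨b, hb, i, hi⟩ := hx.1
      obtain ⟨q, hq, hqex, hpath⟩ := hc.exists_linked n hn hb (i := i) (by rw [hi]; rfl) (r := p)
        ⟨⟨D.mem n hn, rfl, hb⟩, hex.1, hp.symm, ⟨x, hx, hi⟩, .inr hex⟩
      obtain ⟨s, hs0, hsex, hs⟩ := ih _ k hxd hc q hq hqex
      refine ⟨fun i => Nat.casesOn i (n, p) s, rfl, fun i => ?_, fun i hi => ?_⟩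
      · cases i with
        | zero => exact hex
        | succ i => exact hsex i
      · cases i with
        | zero => rw [← hs0] at hpath; exact hpath
        | succ i => exact hs i (Nat.lt_of_succ_lt_succ hi)

/-- A term that is nested too deeply makes some existential position recur. -/
theorem exists_recurrence {t : SkTerm ar C V} {n : ℕ} (hc : D.Created t n)
    (ht : t ∉ boundedTerms Rs F (finite_existential Rs).toFinset.card) :
    ∃ (p : Pos ar C V) (m k : ℕ), p.IsExistential Rs ∧
      Relation.TransGen D.Linked (m, p) (k, p) := by
  obtain ⟨hn, z, hz, rfl⟩ := id hc
  obtain ⟨a, ha, i, hi⟩ := hz.1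
  obtain ⟨s, -, hex, hs⟩ := exists_chain _ _ n ht hc ⟨D.rule n, true, a, i⟩ rfl
    ⟨⟨D.mem n hn, rfl, ha⟩, z, hz, hi⟩
  -- Pigeonhole: a chain with as many links as there are existential positions visits one more
  -- position than that.
  obtain ⟨i, hi, j, hj, hij, he⟩ := Finset.exists_ne_map_eq_of_card_lt_of_maps_to
    (s := Finset.range ((finite_existential Rs).toFinset.card + 1))
    (t := (finite_existential Rs).toFinset) (f := fun i => (s i).2) (by simp)
    (fun i _ => by simpa using hex i)
  rw [Finset.mem_range, Nat.lt_succ_iff] at hi hj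
  have key : ∀ i j, i < j → j ≤ (finite_existential Rs).toFinset.card →
      Relation.TransGen D.Linked (s j) (s i) := by
    intro i j hij hj
    induction j, hij using Nat.le_induction with
    | base => exact hs i hj
    | succ j hij ih => exact (hs j hj).trans (ih (by omega))
  have fin : ∀ i j, i < j → j ≤ (finite_existential Rs).toFinset.card → (s i).2 = (s j).2 →
      ∃ (p : Pos ar C V) (m k : ℕ), p.IsExistential Rs ∧
        Relation.TransGen D.Linked (m, p) (k, p) := fun i j hij hj he =>
    ⟨(s i).2, (s j).1, (s i).1, hex i, by
      have := key i j hij hj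
      rwa [show s j = ((s j).1, (s i).2) by rw [he]] at this⟩
  rcases lt_or_gt_of_ne hij with h | h
  · exact fin i j h hj he
  · exact fin j i h hi he.symm

end Deriv

/-! ### Existential variables of composed rules -/

/-- Composition creates no new existential variables. The critical case is a body variable of `T`
all of whose body atoms are removed: such an atom is equal to one of `μ(H_S)`, so the variable stems
from the head of `S`. -/
theorem CRule.exist_comp {S T : CRule ar C V} {μ : ℕ × V → Tm C (ℕ × V)} {w : ℕ × V}
    (hw : w ∈ (S.comp T μ).exist) : ∃ u, (u ∈ S.exist ∨ u ∈ T.exist) ∧ μ u = .var w := by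
  obtain ⟨hhead, hbody⟩ := hw
  rw [CRule.headAtoms_comp] at hhead
  have hvar : ∀ (a : Atom ar (Tm C (ℕ × V))) i, (a.subst μ).args i = .var w →
      ∃ u, a.args i = .var u ∧ μ u = .var w := by
    intro a i hi
    change (a.args i).subst μ = .var w at hi
    cases hv : a.args i with
    | const c => rw [hv] at hi; cases hi
    | var u => rw [hv] at hi; exact ⟨u, rfl, hi⟩
  have hS : ∀ a ∈ S.headAtoms, ∀ i, (a.subst μ).args i = .var w →
      ∃ u, (u ∈ S.exist ∨ u ∈ T.exist) ∧ μ u = .var w := by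
    intro a ha i hi
    obtain ⟨u, hu, hμ⟩ := hvar a i hi
    refine ⟨u, .inl ⟨⟨a, ha, i, hu⟩, ?_⟩, hμ⟩
    rintro ⟨b, hb, j, hj⟩
    refine hbody ⟨b.subst μ, .inl ⟨b, hb, rfl⟩, j, ?_⟩
    change (b.args j).subst μ = _
    rw [hj]; exact hμ
  obtain ⟨_, ⟨a, ha | ha, rfl⟩, i, hi⟩ := hhead
  · exact hS a ha i hi
  · obtain ⟨u, hu, hμ⟩ := hvar a i hi
    by_cases hb : u ∈ vars T.body
    · obtain ⟨b, hb, j, hj⟩ := hb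
      have hbw : (b.subst μ).args j = .var w := by
        change (b.args j).subst μ = _
        rw [hj]; exact hμ
      by_cases hmem : b.subst μ ∈ substSet μ S.headAtoms
      · obtain ⟨h, hh, he⟩ := hmem
        have : Tm.var w ∈ terms {h.subst μ} := ⟨_, rfl, by rw [he]; exact ⟨j, hbw⟩⟩
        obtain ⟨_, rfl, i', hi'⟩ := this
        exact hS h hh i' hi'
      · exact absurd ⟨_, .inr ⟨⟨b, hb, rfl⟩, hmem⟩, j, hbw⟩ hbody
    · exact ⟨u, .inr ⟨⟨a, ha, i, hu⟩, hb⟩, hμ⟩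

theorem Rule.exist_copy {R : Rule ar C V} {n : ℕ} {w : ℕ × V} (hw : w ∈ (R.copy n).exist) :
    ∃ v ∈ R.exist, w = (n, v) := by
  obtain ⟨hhead, hbody⟩ := hw
  rw [Rule.headAtoms_copy] at hhead
  obtain ⟨_, ⟨a, ha, rfl⟩, i, hi⟩ := hhead
  obtain ⟨v, hv, rfl⟩ := Deriv.exists_ren_of_args hi
  refine ⟨v, ⟨⟨a, ha, i, hv⟩, ?_⟩, rfl⟩
  rintro ⟨b, hb, j, hj⟩
  refine hbody ⟨b.subst (ren n), ⟨b, hb, rfl⟩, j, ?_⟩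
  change (b.args j).subst (ren n) = _
  rw [hj]; rfl

theorem composed_congr {c : ℕ → Pos ar C V} {μ μ' : ℕ → ℕ × V → Tm C (ℕ × V)} {l : ℕ}
    (h : ∀ j < l, μ j = μ' j) : composed c μ l = composed c μ' l := by
  induction l with
  | zero => rfl
  | succ l ih =>
    rw [composed, composed, ih fun j hj => h j (hj.trans l.lt_succ_self), h l l.lt_succ_self]

theorem headAtom_congr {c : ℕ → Pos ar C V} {μ μ' : ℕ → ℕ × V → Tm C (ℕ × V)} {l : ℕ}
    (h : ∀ j < l, μ j = μ' j) : headAtom c μ l = headAtom c μ' l := by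
  cases l with
  | zero => rfl
  | succ l => rw [headAtom, headAtom, h l l.lt_succ_self]

/-! ### Compatible sequences of unifiers along trails. -/

namespace Deriv

variable {Rs : Finset (Rule ar C V)} {F : Finset (Atom ar (Tm C V))}

/-- A sequence of alternating head and body positions in which every head atom is used at the next
body position, with the steps `e l` of the derivation, all of which use rules of one component of the
graph of rule dependencies. -/
structure IsTrail (D : Deriv Rs F) (k : ℕ) (c : ℕ → Pos ar C V) (e : ℕ → ℕ) : Prop where
  pos : ∀ l ≤ k, D.pos (e l)
  rule : ∀ l ≤ k, (c (2 * l)).rule = D.rule (e l)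
  head : ∀ l ≤ k, (c (2 * l)).IsHead Rs
  body : ∀ l < k, (c (2 * l + 1)).IsBody Rs ∧ (c (2 * l + 1)).rule = D.rule (e (l + 1))
  used : ∀ l < k, (c (2 * l)).atom.ev (D.τ (e l)) = (c (2 * l + 1)).atom.ev (D.τ (e (l + 1)))
  reach : ∀ l ≤ k, ∀ l' ≤ k, D.Reach (D.rule (e l)) (D.rule (e l'))

variable {D : Deriv Rs F} {k : ℕ} {c : ℕ → Pos ar C V} {e : ℕ → ℕ}
  {μ : ℕ → ℕ × V → Tm C (ℕ × V)}

variable (D) in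
/-- The joint instantiation of the rules along a trail. -/
def joint (e : ℕ → ℕ) : ℕ × V → SkTerm ar C V := fun w => D.τ (e w.1) w.2

theorem ev_joint (e : ℕ → ℕ) (l : ℕ) (a : Atom ar (Tm C V)) :
    (a.subst (ren l)).ev (D.joint e) = a.ev (D.τ (e l)) := by
  rw [Atom.ev_subst]; congr 1

theorem ev_subst_of_factor {σ : ℕ × V → SkTerm ar C V} {ν : ℕ × V → Tm C (ℕ × V)}
    (hν : ∀ w, (ν w).ev σ = σ w) (a : Atom ar (Tm C (ℕ × V))) : (a.subst ν).ev σ = a.ev σ := by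
  rw [Atom.ev_subst]; congr 1; funext w; exact hν w

theorem IsTrail.realised (h : D.IsTrail k c e) {l : ℕ} (hl : l ≤ k)
    (hμ : ∀ j < l, ∀ w, (μ j w).ev (D.joint e) = D.joint e w) :
    (composed c μ l).Realised (D.joint e) (⋃ n, D.A n) := by
  induction l with
  | zero =>
    have := realised_copy (h.pos 0 hl) 0 (σ := D.joint e) fun _ => rfl
    rwa [← h.rule 0 hl] at this
  | succ l ih =>
    have := realised_copy (h.pos (l + 1) hl) (l + 1) (σ := D.joint e) fun _ => rfl
    rw [← h.rule (l + 1) hl] at this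
    exact (ih (by omega) fun j hj => hμ j (by omega)).comp this (hμ l l.lt_succ_self)

/-- This identifies the ground value of an existential variable with a term created on the trail.
The clause for all head atoms allows any position of the creating rule to serve as the start of the
compatibility path. -/
theorem IsTrail.exists_origin (h : D.IsTrail k c e) {l : ℕ} (hl : l ≤ k)
    (hμ : ∀ j < l, ∀ w, (μ j w).ev (D.joint e) = D.joint e w) {w : ℕ × V}
    (hw : w ∈ (composed c μ l).exist) :
    ∃ m ≤ l, ∃ v ∈ (D.rule (e m)).exist, D.joint e w = D.τ (e m) v ∧
      ∀ a ∈ (D.rule (e m)).head, ∃ θ, (D.rule (e m), a, θ) ∈ (composed c μ l).head ∧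
        θ v = .var w := by
  induction l generalizing w with
  | zero =>
    obtain ⟨v, hv, rfl⟩ := Rule.exist_copy hw
    have hr := h.rule 0 hl
    rw [mul_zero] at hr
    rw [hr] at hv
    refine ⟨0, le_rfl, v, hv, rfl, fun a ha => ⟨ren 0, ⟨a, ?_, ?_⟩, rfl⟩⟩
    · rw [hr]; exact ha
    · rw [hr]
  | succ l ih =>
    obtain ⟨u, hu, huw⟩ := CRule.exist_comp hw
    have hval : D.joint e w = D.joint e u := by
      rw [← hμ l l.lt_succ_self u, huw]; rfl
    rcases hu with hu | hu
    · obtain ⟨m, hm, v, hv, hve, hθ⟩ := ih (by omega) (fun j hj => hμ j (by omega)) hu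
      refine ⟨m, by omega, v, hv, hval.trans hve, fun a ha => ?_⟩
      obtain ⟨θ, hmem, hθv⟩ := hθ a ha
      exact ⟨_, ⟨_, .inl hmem, rfl⟩, by simp only [hθv]; exact huw⟩
    · obtain ⟨v, hv, rfl⟩ := Rule.exist_copy hu
      rw [h.rule (l + 1) hl] at hv
      refine ⟨l + 1, le_rfl, v, hv, hval, fun a ha => ⟨_, ⟨(D.rule (e (l + 1)), a, ren (l + 1)),
        .inr ⟨a, ?_, ?_⟩, rfl⟩, huw⟩⟩
      · rw [h.rule (l + 1) hl]; exact ha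
      · rw [h.rule (l + 1) hl]

theorem IsTrail.headAtom_mem (h : D.IsTrail k c e) {l : ℕ} (hl : l ≤ k) :
    headAtom c μ l ∈ (composed c μ l).headAtoms := by
  cases l with
  | zero =>
    rw [composed, Rule.headAtoms_copy]
    exact ⟨_, (h.head 0 hl).2.2, rfl⟩
  | succ l =>
    rw [composed, CRule.headAtoms_comp, Rule.headAtoms_copy]
    exact ⟨_, .inr ⟨_, (h.head (l + 1) hl).2.2, rfl⟩, rfl⟩

theorem headAtom_ev {l : ℕ} (hμ : ∀ j < l, ∀ w, (μ j w).ev (D.joint e) = D.joint e w) :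
    (headAtom c μ l).ev (D.joint e) = (c (2 * l)).atom.ev (D.τ (e l)) := by
  cases l with
  | zero => exact ev_joint e 0 _
  | succ l => rw [headAtom, ev_subst_of_factor (hμ l l.lt_succ_self), ev_joint]

/-- The next unifier along a trail: the most general unifier of the two linked atoms. -/
theorem IsTrail.exists_compatibleUnifier (h : D.IsTrail k c e) {l : ℕ} (hl : l < k)
    (hμ : ∀ j < l, ∀ w, (μ j w).ev (D.joint e) = D.joint e w) :
    ∃ ν, (∀ w, (ν w).ev (D.joint e) = D.joint e w) ∧ ∃ B' H',
      CompatibleUnifier Rs (composed c μ l) (c (2 * (l + 1))).rule (l + 1) B' H' ν ∧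
      headAtom c μ l ∈ H' ∧ (c (2 * l + 1)).atom.subst (ren (l + 1)) ∈ B' ∧
      (headAtom c μ l).subst ν = ((c (2 * l + 1)).atom.subst (ren (l + 1))).subst ν := by
  have hrule := h.rule (l + 1) hl
  have hbody : (c (2 * l + 1)).atom ∈ (D.rule (e (l + 1))).body := by
    rw [← (h.body l hl).2]; exact (h.body l hl).1.2.2
  obtain ⟨ν, hν, hfac⟩ := exists_unifier
    (B := ((c (2 * (l + 1))).rule.copy (l + 1)).body) (H := (composed c μ l).headAtoms)
    (B' := {(c (2 * l + 1)).atom.subst (ren (l + 1))}) (H' := {headAtom c μ l})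
    (by rw [Set.singleton_subset_iff, hrule]; exact ⟨_, hbody, rfl⟩)
    (Set.singleton_subset_iff.2 (h.headAtom_mem hl.le))
    (Set.finite_singleton _) (Set.finite_singleton _) (D.joint e)
    (by rw [Set.image_singleton, Set.image_singleton, ev_joint, headAtom_ev hμ, h.used l hl])
  refine ⟨ν, hfac, _, _, ⟨hν, ?_⟩, rfl, rfl, ?_⟩
  -- Under the joint instantiation the identification becomes an equality with a created term, whose
  -- route to this position is the path demanded by compatibility.
  · rintro a ha - i z ⟨hz, -⟩ hza
    obtain ⟨m, hm, v, hv, hvz, hθ⟩ := h.exists_origin hl.le hμ hz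
    rw [hrule] at ha ⊢
    have hval : (a.args i).ev (D.τ (e (l + 1))) = D.τ (e m) v := by
      have := congrArg (Tm.ev (D.joint e)) hza
      rw [hfac, hvz, Tm.ev_subst] at this
      simp only [hfac] at this
      rw [Tm.ev_subst] at this
      exact this
    have hpm := h.pos m (by omega)
    obtain ⟨a', ha', j, z', hz', haz, htz, hpath⟩ :=
      Created.exists_path (D := D) ⟨hpm, v, hv, rfl⟩ (e (l + 1)) (h.pos (l + 1) hl) ha hval
        (h.reach _ hl _ (by omega))
    obtain rfl := created_inj hv hz' htz
    obtain ⟨θ, hmem, hθv⟩ := hθ a' ha'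
    refine ⟨_, ⟨θ, hmem, ?_⟩, hpath⟩
    change (a'.args j).subst θ = _
    rw [haz]; exact hθv
  · have := hν.unifies
    rw [substSet, substSet, Set.image_singleton, Set.image_singleton] at this
    exact (Set.singleton_injective this).symm

/-- The unifiers are chosen successively; updating at `l` is harmless because the rule composed so
far involves only earlier ones. -/
theorem IsTrail.exists_induced (h : D.IsTrail k c e) : ∀ l ≤ k, ∃ μ, InducedCompatible Rs l c μ ∧
    ∀ j < l, ∀ w, (μ j w).ev (D.joint e) = D.joint e w := by
  intro l
  induction l with
  | zero =>
    exact fun _ => ⟨fun _ => Tm.var, fun j hj => absurd hj (Nat.not_lt_zero j),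
      fun j hj => absurd hj (Nat.not_lt_zero j)⟩
  | succ l ih =>
    intro hl
    obtain ⟨μ, hμ, hfac⟩ := ih (by omega)
    obtain ⟨ν, hν, hνu⟩ := h.exists_compatibleUnifier hl hfac
    have hlt : ∀ j < l, Function.update μ l ν j = μ j := fun j hj =>
      Function.update_of_ne hj.ne _ _
    have hcongr : ∀ j ≤ l, composed c (Function.update μ l ν) j = composed c μ j ∧
        headAtom c (Function.update μ l ν) j = headAtom c μ j := fun j hj =>
      ⟨composed_congr fun i hi => hlt i (by omega), headAtom_congr fun i hi => hlt i (by omega)⟩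
    refine ⟨Function.update μ l ν, fun j hj => ?_, fun j hj => ?_⟩
    · rw [(hcongr j (by omega)).1, (hcongr j (by omega)).2]
      rcases (Nat.lt_succ_iff.1 hj).eq_or_lt with rfl | hj'
      · rw [Function.update_self]; exact hνu
      · rw [hlt j hj']; exact hμ j hj'
    · rcases (Nat.lt_succ_iff.1 hj).eq_or_lt with rfl | hj'
      · rw [Function.update_self]; exact hν
      · rw [hlt j hj']; exact hfac j hj'

/-- A cycle followed by a sound derivation is compatible and not self-blocking. -/
theorem IsTrail.compatible (h : D.IsTrail k c e) {p : Pos ar C V} (hc : IsCycle Rs p k c) :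
    IsCompatibleCycle Rs p k c ∧ ¬ SelfBlockingCycle Rs k c := by
  obtain ⟨μ, hμ, hfac⟩ := h.exists_induced k le_rfl
  exact ⟨⟨hc, μ, hμ⟩, fun hs => (h.realised le_rfl hfac).not_selfBlocking (hs μ hμ)⟩

theorem exists_seq_of_transGen {α : Type*} {r : α → α → Prop} {x y : α}
    (h : Relation.TransGen r x y) :
    ∃ (k : ℕ) (s : ℕ → α), 0 < k ∧ s 0 = x ∧ s k = y ∧ ∀ l < k, r (s l) (s (l + 1)) := by
  induction h with
  | single h =>
    rename_i y
    exact ⟨1, fun l => if l = 0 then x else y, one_pos, rfl, rfl, fun l hl => by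
      obtain rfl : l = 0 := by omega
      exact h⟩
  | tail _ h ih =>
    rename_i y z _
    obtain ⟨k, s, hk, h0, hk', hs⟩ := ih
    refine ⟨k + 1, fun l => if l ≤ k then s l else z, by omega, by simpa using h0, by simp, ?_⟩
    intro l hl
    rcases (Nat.lt_succ_iff.1 hl).eq_or_lt with rfl | hl'
    · simpa [hk'] using h
    · have h1 : l + 1 ≤ k := hl'
      simpa [hl'.le, h1] using hs l hl'

/-- A recurring position lies on a compatible cycle that is not self-blocking. -/
theorem exists_cycle {p : Pos ar C V} {m n : ℕ} (h : Relation.TransGen D.Linked (m, p) (n, p)) :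
    ∃ k c, IsCompatibleCycle Rs p k c ∧ ¬ SelfBlockingCycle Rs k c := by
  obtain ⟨k, s, hk, h0, hk', hs⟩ := exists_seq_of_transGen h
  have hq : ∀ l, ∃ q, l < k → D.Link (s l) q (s (l + 1)) := by
    intro l
    by_cases hl : l < k
    · exact (hs l hl).imp fun q hq _ => hq
    · exact ⟨p, fun h => absurd h hl⟩
  choose q hq using hq
  let c : ℕ → Pos ar C V := fun n => if n % 2 = 0 then (s (n / 2)).2 else q (n / 2)
  have hc0 : ∀ l, c (2 * l) = (s l).2 := fun l => by simp [c]
  have hc1 : ∀ l, c (2 * l + 1) = q l := fun l => by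
    have h1 : (2 * l + 1) % 2 = 1 := by omega
    have h2 : (2 * l + 1) / 2 = l := by omega
    simp [c, h1, h2]
  have hlink : ∀ l < k, D.Link (s l) (q l) (s (l + 1)) := fun l hl => hq l hl
  have hpos : ∀ l ≤ k, D.pos (s l).1 := by
    intro l hl
    rcases hl.eq_or_lt with rfl | hl
    · obtain ⟨j, rfl⟩ := Nat.exists_eq_succ_of_ne_zero hk.ne'
      exact (hlink j j.lt_succ_self).2.2.2.1
    · exact (hlink l hl).2.2.2.2.2.1.1
  have hhead : ∀ l ≤ k, (s l).2.IsHead Rs ∧ (s l).2.rule = D.rule (s l).1 := by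
    intro l hl
    rcases hl.eq_or_lt with rfl | hl
    · obtain ⟨j, rfl⟩ := Nat.exists_eq_succ_of_ne_zero hk.ne'
      obtain ⟨-, -, hr, -, -, -, -, hi⟩ := hlink j j.lt_succ_self
      exact ⟨hi.2.1, hi.2.2.1.symm.trans hr⟩
    · exact ⟨(hlink l hl).1, (hlink l hl).2.1⟩
  have hbody : ∀ l < k, (q l).IsBody Rs := fun l hl => (hlink l hl).2.2.2.2.2.2.2.1
  have hfwd : ∀ l' ≤ k, ∀ l ≤ l', D.Reach (D.rule (s l).1) (D.rule (s l').1) := by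
    intro l' hl' l hll
    induction l', hll using Nat.le_induction with
    | base => exact .refl
    | succ l' hll ih =>
      obtain ⟨-, -, hr, hp, -, hmade, -, -⟩ := hlink l' hl'
      have hb := (hbody l' hl').2.2
      rw [hr] at hb
      exact (ih (by omega)).trans (hmade.transGen hp hb).to_reflTransGen
  -- The two end steps may differ, but they share the position and hence the rule. So all rules of
  -- the walk reach each other, as transition edges require.
  have hclose : D.rule (s k).1 = D.rule (s 0).1 := by
    rw [← (hhead k le_rfl).2, ← (hhead 0 k.zero_le).2, hk', h0]
  have hreach : ∀ l ≤ k, ∀ l' ≤ k, D.Reach (D.rule (s l).1) (D.rule (s l').1) := by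
    intro l hl l' hl'
    have h1 := hfwd k le_rfl l hl
    rw [hclose] at h1
    exact h1.trans (hfwd l' hl' 0 l'.zero_le)
  have htrail : D.IsTrail k c fun l => (s l).1 := by
    refine ⟨hpos, ?_, ?_, ?_, ?_, hreach⟩ <;> intro l hl
    · rw [hc0]; exact (hhead l hl).2
    · rw [hc0]; exact (hhead l hl).1
    · rw [hc1]; exact ⟨hbody l hl, (hlink l hl).2.2.1⟩
    · rw [hc0, hc1]; exact (hlink l hl).2.2.2.2.1
  refine ⟨k, c, htrail.compatible ⟨hk, ?_, ?_, ?_⟩⟩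
  · rw [← mul_zero 2, hc0, h0]
  · rw [hc0, hk']
  · intro n hn
    rcases Nat.even_or_odd' n with ⟨l, rfl | rfl⟩
    · have hl : l < k := by omega
      rw [hc0, hc1]
      obtain ⟨h1, h2, h3, h4, h5, h6, h7, -⟩ := hlink l hl
      exact .inr (transitionEdge h4 h1 h2 (hbody l hl) h3 h5 h6 h7
        (hreach _ hl _ hl.le))
    · have hl : l < k := by omega
      rw [show 2 * l + 1 + 1 = 2 * (l + 1) by ring, hc0, hc1]
      exact .inl (hlink l hl).2.2.2.2.2.2.2

/-- If all compatible cycles are self-blocking, then the nesting of the terms is bounded. -/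
theorem terms_subset (hblock : ∀ p : Pos ar C V, p.IsExistential Rs →
      ∀ (k : ℕ) (c : ℕ → Pos ar C V), IsCompatibleCycle Rs p k c → SelfBlockingCycle Rs k c)
    (D : Deriv Rs F) (n : ℕ) :
    terms (D.A n) ⊆ boundedTerms Rs F (finite_existential Rs).toFinset.card := by
  intro t ht
  by_contra hd
  rcases occ_cases ht with hb | ⟨k, -, hc⟩
  · exact hd (baseTerms_subset _ _ _ hb)
  · obtain ⟨p, m, k, hp, hr⟩ := exists_recurrence hc hd
    obtain ⟨k, c, h1, h2⟩ := exists_cycle hr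
    exact h2 (hblock p hp k c h1)

end Deriv

/-! ### Infinite branches -/

/-- The rule application is possible and its positive child is not unsound. -/
def Node.Useful (Rs : Finset (Rule ar C V)) (N : Node ar C V) (R : Rule ar C V)
    (π : V → SkTerm ar C V) : Prop :=
  N.Expandable Rs R π ∧ ¬ (N.pos R π).Unsound

/-- If no application is useful at an incomplete node, then nothing can be inferred below it, so that
the atoms to be proven stay unproven. -/
theorem unprovable_of_not_useful {Rs : Finset (Rule ar C V)} {N : Node ar C V} (hN : ¬ N.Unsound)
    (hc : ¬ DerivationComplete Rs N.IN N.OUT) (hu : ∀ R π, ¬ N.Useful Rs R π) :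
    N.Unprovable Rs := by
  have hout : ∀ O ∈ N.OUT, ¬ O ⊆ N.IN := fun O hO hsub =>
    hN ⟨O, hO, hsub.trans Set.subset_union_left⟩
  have : ∃ R ∈ Rs, ∃ π, Applicable N.IN R π ∧ ¬ R.headInst π ⊆ N.IN ∧
      ∀ O ∈ N.OUT ∪ R.negInst π, ¬ O ⊆ N.IN ∪ R.headInst π := by
    by_contra hno
    refine hc ⟨hout, fun R hR π happ => ?_⟩
    by_contra hno'
    rw [not_or] at hno'
    exact hno ⟨R, hR, π, happ, hno'.1, fun O hO hsub => hno'.2 ⟨O, hO, hsub⟩⟩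
  obtain ⟨R, hR, π, happ, hnew, hok⟩ := this
  have hexp : N.Expandable Rs R π :=
    ⟨hN, hR, happ, fun O hO hsub => hok O (.inr hO) (hsub.trans Set.subset_union_left), hnew⟩
  have huns : (N.pos R π).Unsound := by
    by_contra h
    exact hu R π ⟨hexp, h⟩
  obtain ⟨O, hO, hsub⟩ := huns
  -- Only atoms of `MBT` can make this child unsound, so some atom `x` to be proven is not yet
  -- inferred.
  obtain ⟨x, hxO, hx⟩ := Set.not_subset.1 (hok O hO)
  have hxM : x ∈ N.MBT := (hsub hxO).resolve_left hx
  refine ⟨⟨x, hxM⟩, ?_⟩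
  rintro ⟨c, h0, hstep, hsound, -, hstable⟩
  -- A first positive step of the continuation would be useful already at `N`, where `MBT` is
  -- smaller. Hence only negative steps occur and `x` is never inferred.
  have inv : ∀ n, (c n).IN = N.IN ∧ (c n).OUT = N.OUT ∧ N.MBT ⊆ (c n).MBT := by
    intro n
    induction n with
    | zero => rw [h0]; exact ⟨rfl, rfl, subset_rfl⟩
    | succ n ih =>
      obtain ⟨h1, h2, h3⟩ := ih
      rcases hstep n with h | ⟨R', π', hexp', h | ⟨O', -, h⟩⟩
      · rw [h]; exact ⟨h1, h2, h3⟩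
      · exfalso
        obtain ⟨-, hR', happ', hneg', hnew'⟩ := hexp'
        rw [h1] at happ' hneg' hnew'
        refine hu R' π' ⟨⟨hN, hR', happ', hneg', hnew'⟩, ?_⟩
        rintro ⟨O', hO', hsub'⟩
        refine hsound (n + 1) ⟨O', ?_, ?_⟩ <;> rw [h]
        · simpa only [Node.pos, h2] using hO'
        · refine hsub'.trans ?_
          simp only [Node.pos, h1]
          exact Set.union_subset_union_right _ h3
      · rw [h]
        exact ⟨h1, h2, h3.trans Set.subset_union_left⟩
  obtain ⟨n, hn⟩ := Set.mem_iUnion.1 (hstable (Set.mem_iUnion.2 ⟨0, h0 ▸ hxM⟩))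
  exact hx (.inl ((inv n).1 ▸ hn))

/-- The application is useful even if the chosen child is a negative one; this is what makes `MBT`
grow there. -/
theorem exists_useful {Rs : Finset (Rule ar C V)} {N : Node ar C V} (h : ¬ FiniteChaseTree Rs N) :
    ∃ N', ¬ FiniteChaseTree Rs N' ∧ ∃ R π, N.Useful Rs R π ∧
      (N' = N.pos R π ∨ ∃ O ∈ R.negInst π, N' = N.negChild O) := by
  have hN : ¬ N.Unsound := fun hN => h (.unsound N hN)
  have hc : ¬ DerivationComplete Rs N.IN N.OUT := fun hc => h (.complete N hN hc)
  have : ∃ R π, N.Useful Rs R π := by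
    by_contra! hu
    exact h (.unprovable N (unprovable_of_not_useful hN hc hu))
  obtain ⟨R, π, hu⟩ := this
  by_contra! hno
  refine h (.expand N R π hu.1 ?_ fun O hO => ?_)
  · by_contra hf
    exact (hno _ hf R π hu).1 rfl
  · by_contra hf
    exact (hno _ hf R π hu).2 O hO rfl

theorem instSet_eq (π : V → SkTerm ar C V) (A : Set (Atom ar (Tm C V))) :
    instSet π A = Atom.ev π '' A := by
  rw [instSet, Tm.inst_eq_ev]; rfl

theorem Rule.ev_skolemize {R : Rule ar C V} (π : V → SkTerm ar C V) {a : Atom ar (Tm C V)}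
    (h : ∀ i v, a.args i = .var v → v ∈ vars (R.body : Set (Atom ar (Tm C V)))) :
    a.ev (R.skolemize π) = a.ev π :=
  Atom.ev_congr fun i v hv => if_neg fun hx => hx.2 (h i v hv)

/-- An infinite branch without unsound nodes. -/
structure Branch (Rs : Finset (Rule ar C V)) (F : Finset (Atom ar (Tm C V))) where
  node : ℕ → Node ar C V
  rule : ℕ → Rule ar C V
  sub : ℕ → V → SkTerm ar C V
  zero : node 0 = root F
  useful : ∀ n, (node n).Useful Rs (rule n) (sub n)
  step : ∀ n, node (n + 1) = (node n).pos (rule n) (sub n) ∨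
    ∃ O ∈ (rule n).negInst (sub n), node (n + 1) = (node n).negChild O

theorem exists_branch {Rs : Finset (Rule ar C V)} {F : Finset (Atom ar (Tm C V))}
    (h : ¬ FiniteChaseTree Rs (root F)) : Nonempty (Branch Rs F) := by
  have hex : ∀ N : {N : Node ar C V // ¬ FiniteChaseTree Rs N},
      ∃ N' : {N : Node ar C V // ¬ FiniteChaseTree Rs N}, ∃ R π, N.1.Useful Rs R π ∧
        (N'.1 = N.1.pos R π ∨ ∃ O ∈ R.negInst π, N'.1 = N.1.negChild O) := fun N => by
    obtain ⟨N', hN', hr⟩ := exists_useful N.2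
    exact ⟨⟨N', hN'⟩, hr⟩
  choose next R π hu hs using hex
  let s : ℕ → {N : Node ar C V // ¬ FiniteChaseTree Rs N} := fun n => next^[n] ⟨root F, h⟩
  have hsucc : ∀ n, s (n + 1) = next (s n) := fun n => Function.iterate_succ_apply' _ _ _
  exact ⟨fun n => (s n).1, fun n => R (s n), fun n => π (s n), rfl, fun n => hu _, fun n => by
    rw [hsucc]; exact hs _⟩

namespace Branch

variable {Rs : Finset (Rule ar C V)} {F : Finset (Atom ar (Tm C V))} (b : Branch Rs F)

theorem step_cases (n : ℕ) :
    (b.node (n + 1)).IN = (b.node n).IN ∪ (b.rule n).headInst (b.sub n) ∧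
        (b.node (n + 1)).OUT = (b.node n).OUT ∪ (b.rule n).negInst (b.sub n) ∧
        (b.node (n + 1)).MBT = (b.node n).MBT ∨
      (b.node (n + 1)).IN = (b.node n).IN ∧ (b.node (n + 1)).OUT = (b.node n).OUT ∧
        ∃ O ∈ (b.rule n).negInst (b.sub n), (b.node (n + 1)).MBT = (b.node n).MBT ∪ O := by
  rcases b.step n with h | ⟨O, hO, h⟩
  · exact .inl ⟨by rw [h]; rfl, by rw [h]; rfl, by rw [h]; rfl⟩
  · exact .inr ⟨by rw [h]; rfl, by rw [h]; rfl, O, hO, by rw [h]; rfl⟩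

theorem in_mono : Monotone fun n => (b.node n).IN :=
  monotone_nat_of_le_succ fun n => by
    rcases b.step_cases n with ⟨h, -, -⟩ | ⟨h, -, -⟩ <;> rw [h]
    exact Set.subset_union_left

theorem out_mono : Monotone fun n => (b.node n).OUT :=
  monotone_nat_of_le_succ fun n => by
    rcases b.step_cases n with ⟨-, h, -⟩ | ⟨-, h, -⟩ <;> rw [h]
    exact Set.subset_union_left

/-- The inferred atoms and the atoms to be proven grow strictly along the branch. -/
theorem strictMono : StrictMono fun n => ((b.node n).IN, (b.node n).MBT) :=
  strictMono_nat_of_lt_succ fun n => by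
    obtain ⟨⟨-, -, -, -, hnew⟩, hsound⟩ := b.useful n
    rcases b.step_cases n with ⟨h1, -, h2⟩ | ⟨h1, -, O, hO, h2⟩ <;> rw [h1, h2]
    · refine lt_of_le_of_ne ⟨Set.subset_union_left, le_rfl⟩ fun he => hnew ?_
      rw [(Prod.mk.inj he).1]
      exact Set.subset_union_right
    -- If the negative body were already in `MBT`, the positive child would be unsound.
    · refine lt_of_le_of_ne ⟨le_rfl, Set.subset_union_left⟩ fun he => hsound ⟨O, .inr hO, ?_⟩
      refine Set.Subset.trans ?_ Set.subset_union_right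
      change O ⊆ (b.node n).MBT
      rw [(Prod.mk.inj he).2]
      exact Set.subset_union_right

/-- A finite set inside the union lies in one stage; at a late enough node it is also forbidden,
which makes that node unsound. -/
theorem not_subset_iUnion {O : Set (Atom ar (SkTerm ar C V))} (hO : O.Finite) {m : ℕ}
    (hm : O ∈ (b.node m).OUT) : ¬ O ⊆ ⋃ n, (b.node n).IN := by
  intro hsub
  obtain ⟨I, hI, hOI⟩ := Set.finite_subset_iUnion hO hsub
  obtain ⟨n, hn⟩ := hI.bddAbove
  refine (b.useful (max m n)).1.1 ⟨O, b.out_mono (le_max_left m n) hm, ?_⟩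
  refine hOI.trans (Set.Subset.trans ?_ Set.subset_union_left)
  exact Set.iUnion₂_subset fun i hi => b.in_mono ((hn hi).trans (le_max_right m n))

/-- The sound derivation along the branch. -/
noncomputable def deriv : Deriv Rs F where
  A n := (b.node n).IN
  pos n := b.node (n + 1) = (b.node n).pos (b.rule n) (b.sub n)
  rule := b.rule
  τ n := (b.rule n).skolemize (b.sub n)
  zero := by rw [b.zero]; rfl
  step_pos n h := by rw [h, ← instSet_eq]; rfl
  step_neg n h := by
    obtain ⟨O, -, h'⟩ := (b.step n).resolve_left h
    rw [h']; rfl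
  mem n _ := (b.useful n).1.2.1
  app n _ a ha := by
    rw [Rule.ev_skolemize _ fun i v hv => ⟨a, ha, i, hv⟩]
    refine (b.useful n).1.2.2.1 ?_
    rw [instSet_eq]
    exact ⟨a, ha, rfl⟩
  new n _ := by
    rw [← instSet_eq]
    exact (b.useful n).1.2.2.2.2
  sound n hn N hN := by
    have he : Atom.ev ((b.rule n).skolemize (b.sub n)) '' (N : Set (Atom ar (Tm C V))) =
        instSet (b.sub n) N := by
      rw [instSet_eq]
      exact Set.image_congr fun a ha =>
        Rule.ev_skolemize _ fun i v hv => (b.rule n).safe N hN ⟨a, ha, i, hv⟩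
    rw [he]
    refine b.not_subset_iUnion (N.finite_toSet.image _) (m := n + 1) ?_
    rw [hn]
    exact .inr ⟨N, hN, rfl⟩
  sk n z hz := by
    rw [Rule.skolemize, if_pos hz]
    congr 1
    funext x
    exact (if_neg (Deriv.frontier_disjoint_exist x.2)).symm

end Branch

/-! ### Finiteness of the atoms on a branch. -/

/-- The atoms with a predicate that occurs in the fact base or in the rules, and with terms from `S`. -/
def universeOver (Rs : Finset (Rule ar C V)) (F : Finset (Atom ar (Tm C V)))
    (S : Set (SkTerm ar C V)) : Set (Atom ar (SkTerm ar C V)) :=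
  {a | (∃ f ∈ templates Rs F, f.pred = a.pred) ∧ ∀ i, a.args i ∈ S}

theorem finite_universeOver (Rs : Finset (Rule ar C V)) (F : Finset (Atom ar (Tm C V)))
    {S : Set (SkTerm ar C V)} (hS : S.Finite) : (universeOver Rs F S).Finite := by
  refine Set.Finite.subset (s := ⋃ f ∈ templates Rs F,
    (fun x => (⟨f.pred, x⟩ : Atom ar (SkTerm ar C V))) '' {x | ∀ i, x i ∈ S}) ?_ ?_
  · exact (finite_templates Rs F).biUnion fun f _ => (Set.Finite.pi' fun _ => hS).image _
  · rintro ⟨p, x⟩ ⟨⟨f, hf, rfl⟩, hx⟩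
    exact Set.mem_biUnion hf ⟨x, hx, rfl⟩

namespace Branch

variable {Rs : Finset (Rule ar C V)} {F : Finset (Atom ar (Tm C V))} (b : Branch Rs F)
  {S : Set (SkTerm ar C V)}

theorem in_subset (hS : ∀ n, terms (b.node n).IN ⊆ S) (n : ℕ) :
    (b.node n).IN ⊆ universeOver Rs F S := by
  refine fun a ha => ⟨?_, fun i => hS n ⟨a, ha, i, rfl⟩⟩
  induction n with
  | zero =>
    rw [b.zero] at ha
    obtain ⟨f, hf, rfl⟩ := ha
    exact ⟨f, .inl hf, rfl⟩
  | succ n ih =>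
    rcases b.step_cases n with ⟨h, -, -⟩ | ⟨h, -, -⟩ <;> rw [h] at ha
    · rcases ha with ha | ⟨f, hf, rfl⟩
      · exact ih ha
      · exact ⟨f, head_subset_templates F (b.useful n).1.2.1 hf, rfl⟩
    · exact ih ha

/-- By safety, the variables of a negative body occur in the positive body, so their values already
occur in `IN`. -/
theorem mbt_subset (hbase : baseTerms Rs F ⊆ S) (hS : ∀ n, terms (b.node n).IN ⊆ S) (n : ℕ) :
    (b.node n).MBT ⊆ universeOver Rs F S := by
  induction n with
  | zero => rw [b.zero]; exact Set.empty_subset _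
  | succ n ih =>
    rcases b.step_cases n with ⟨-, -, h⟩ | ⟨-, -, O, ⟨N, hN, rfl⟩, h⟩ <;> rw [h]
    · exact ih
    · refine Set.union_subset ih ?_
      rintro _ ⟨a, ha, rfl⟩
      obtain ⟨⟨-, hR, happ, -, -⟩, -⟩ := b.useful n
      have hat := neg_subset_templates F hR hN ha
      refine ⟨⟨a, hat, rfl⟩, fun i => ?_⟩
      change (a.args i).inst (b.sub n) ∈ S
      cases hv : a.args i with
      | const c => exact hbase ⟨.const c, ⟨a, hat, i, hv⟩, rfl⟩
      | var v =>
        obtain ⟨f, hf, j, hj⟩ := (b.rule n).safe N hN ⟨a, ha, i, hv⟩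
        refine hS n ⟨_, happ ⟨f, hf, rfl⟩, j, ?_⟩
        change (f.args j).inst (b.sub n) = _
        rw [hj]

end Branch

end NME

theorem mainTheorem9 {P C V : Type*} (ar : P → ℕ) (Rs : Finset (NME.Rule ar C V))
    (hblock : ∀ p : NME.Pos ar C V, p.IsExistential Rs →
      ∀ (k : ℕ) (c : ℕ → NME.Pos ar C V), NME.IsCompatibleCycle Rs p k c →
        NME.SelfBlockingCycle Rs k c) :
    ∀ F : Finset (NME.Atom ar (NME.Tm C V)), NME.SkolemChaseTreeHalts Rs F := by
  intro F
  by_contra hF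
  obtain ⟨b⟩ := NME.exists_branch hF
  have hS := NME.Deriv.terms_subset hblock b.deriv
  have hU := NME.finite_universeOver Rs F (NME.finite_boundedTerms Rs F
    (NME.finite_existential Rs).toFinset.card)
  -- The strictly increasing pairs (`IN`, `MBT`) would be infinitely many pairs of subsets of a
  -- finite set.
  refine Set.infinite_of_injective_forall_mem b.strictMono.injective
    (s := {U | U ⊆ NME.universeOver Rs F _} ×ˢ {U | U ⊆ NME.universeOver Rs F _}) ?_
    (hU.finite_subsets.prod hU.finite_subsets)
  exact fun n => ⟨b.in_subset hS n, b.mbt_subset (NME.baseTerms_subset _ _ _) hS n⟩
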